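/- **Setting.** Let $d\ge 1$ and let $D\subset\mathbb R^d$ be a bounded, connected domain with Lipschitz boundary. Let $V\in C^2(\mathbb R)$ be even with $c_-\le V''\le c_+$ for some constants $c_-,c_+>0$, and let $\sigma:\mathbb R^d\to\mathbb R$ be the surface tension of $V$, i.e. $$\sigma(u)=\lim_{N\to\infty}-\frac1{N^d}\log\frac{Z_N(u)}{Z_N(0)},\qquad Z_N(u)=\int_{\mathbb R^{\Lambda_N}}e^{-H_N^u(\phi)}\prod_{x\in\Lambda_N}d\phi(x),$$ where $\Lambda_N=\{1,\dots,N\}^d$ and $H_N^u(\phi)$ is the sum of $V(\phi(x)-\phi(y))$ over the nearest neighbour bonds $\{x,y\}$ of $\mathbb Z^d$ that touch $\Lambda_N$, with $\phi(x)=u\cdot x$ for $x\notin\Lambda_N$. **Spaces.** $H^1(D)^*$ is the dual of $H^1(D)$, with pairing $\langle\cdot,\cdot\rangle$ that extends $\langle f,J\rangle=(f,J)_{L^2(D)}$ for $f\in L^2(D)$. Let $H=\{\ell\in H^1(D)^*:\langle \ell,1\rangle=0\}$. For $\ell\in H$ let $G\ell\in H^1(D)$ be the unique solution $g$ of $(\nabla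 g,\nabla J)_{L^2(D)}=\langle \ell,J\rangle$ for all $J\in H^1(D)$, $(g,1)_{L^2(D)}=0$, and put $(\ell_1,\ell_2)_H=(\nabla G\ell_1,\nabla G\ell_2)_{L^2(D)}$, $\|\ell\|_H^2=(\ell,\ell)_H$. Let $\mathcal V=\{v\in H^1_0(D):\int_D v=0\}$; $H$ is embedded in $\mathcal V^*$ by $\langle \ell,g\rangle=(\ell,g)_H$ for $\ell\in H$, $g\in\mathcal V$. For $f\in H^1_0(D)$ the operator $A_f:\mathcal V\to\mathcal V^*$, $A_f(v)=-\Delta\,\mathrm{div}(\nabla\sigma(\nabla v+\nabla f))$, is given by $\langle A_f(v),g\rangle=-(\nabla\sigma(\nabla v+\nabla f),\nabla g)_{L^2(D)}$ for $g\in\mathcal V$. **Solutions.** Let $T>0$ and $h_0\in H^1(D)^*$. A function $h:[0,T]\to H^1(D)^*$ is a solution on $[0,T]$, with initial datum $h_0$, of $$\partial_t h=-\Delta\,\mathrm{div}\{(\nabla\sigma)(\nabla h)\}\ \text{ in } D,\qquad h=0\ \text{ outside } D,$$ if there is $f\in H^1_0(D)$ with $\langle h_0,1\rangle=\langle f,1\rangle$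 such that $h_f:=h-f$ is absolutely continuous as a map $[0,T]\to \mathcal V^*$, $h_f\in C([0,T];H)\cap L^2(0,T;\mathcal V)\cap W^{1,2}([0,T],\mathcal V^*)$, $h_f(0)=h_0-f$, and $\frac{d}{dt}h_f(t)=A_f(h_f(t))$ in $\mathcal V^*$ for almost every $t\in[0,T]$. A function $h:[0,\infty)\to H^1(D)^*$ is a solution on $[0,\infty)$ if it is a solution on $[0,T]$ for every $T>0$. **Proposition.** Let $h$ and $\hat h$ be two solutions on $[0,T]$ (respectively on $[0,\infty)$) whose initial data have the same volume, $\langle h(0),1\rangle=\langle\hat h(0),1\rangle$. Then, for all $t\in[0,T]$ (respectively for all $t\ge0$), $h(t)-\hat h(t)\in H$ and $$\|h(t)-\hat h(t)\|_H\le\|h(0)-\hat h(0)\|_H .$$ -/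

import Mathlib

open MeasureTheory Filter Topology
open scoped ContDiff

noncomputable section

namespace SurfaceDiffusion

/-- Euclidean space `ℝ^d`. -/
abbrev E (d : ℕ) := EuclideanSpace ℝ (Fin d)

/-! ### The interaction potential and the surface tension -/

/-- The interaction potential: `V ∈ C²(ℝ)` is even and `c₋ ≤ V'' ≤ c₊` for some `c₋, c₊ > 0`. -/
structure IsPotential (V : ℝ → ℝ) : Prop where
  contDiff : ContDiff ℝ 2 V
  even : ∀ η, V (-η) = V η
  elliptic : ∃ cm cp : ℝ, 0 < cm ∧ 0 < cp ∧
    ∀ η, cm ≤ deriv (deriv V) η ∧ deriv (deriv V) η ≤ cp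

/-- The `2d` nearest neighbours of a site of `ℤ^d`. -/
def neighbors {d : ℕ} (x : Fin d → ℤ) : Finset (Fin d → ℤ) :=
  Finset.univ.biUnion fun i : Fin d => {x + Pi.single i 1, x - Pi.single i 1}

/-- The energy in the finite set `Γ ⊂ ℤ^d` of a height function `φ` on `ℤ^d`: every bond that
touches `Γ` is counted once. -/
def hamiltonian {d : ℕ} (V : ℝ → ℝ) (Γ : Finset (Fin d → ℤ)) (φ : (Fin d → ℤ) → ℝ) : ℝ :=
  (1 / 2) * ∑ x ∈ Γ, ∑ y ∈ (neighbors x).filter (fun y => y ∈ Γ), V (φ x - φ y) +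
    ∑ x ∈ Γ, ∑ y ∈ (neighbors x).filter (fun y => y ∉ Γ), V (φ x - φ y)

/-- The height function which equals `φ` on `Γ` and the plane `x ↦ u · x` outside `Γ`. -/
def withTiltedBoundary {d : ℕ} (Γ : Finset (Fin d → ℤ)) (u : E d) (φ : Γ → ℝ) :
    (Fin d → ℤ) → ℝ :=
  fun x => if hx : x ∈ Γ then φ ⟨x, hx⟩ else ∑ i, u i * (x i : ℝ)

/-- The partition function in `Γ` with boundary condition of tilt `u`. -/
def partitionFunction {d : ℕ} (V : ℝ → ℝ) (Γ : Finset (Fin d → ℤ)) (u : E d) : ℝ :=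
  ∫ φ : Γ → ℝ, Real.exp (-hamiltonian V Γ (withTiltedBoundary Γ u φ))

/-- The cube `{1, …, N}^d`. -/
def cube (d N : ℕ) : Finset (Fin d → ℤ) :=
  Fintype.piFinset fun _ => Finset.Icc 1 (N : ℤ)

/-- `σ` is the surface tension of the potential `V`:
`σ(u) = lim_{N → ∞} - N^{-d} log (Z_N(u) / Z_N(0))`. -/
def IsSurfaceTension {d : ℕ} (V : ℝ → ℝ) (σ : E d → ℝ) : Prop :=
  ∀ u : E d, Tendsto
    (fun N : ℕ => -((N : ℝ) ^ d)⁻¹ *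
      Real.log (partitionFunction V (cube d N) u / partitionFunction V (cube d N) 0))
    atTop (𝓝 (σ u))

/-! ### The macroscopic domain -/

/-- `D` has a Lipschitz boundary: near each boundary point, `D` is the region below the graph
of a Lipschitz function over a hyperplane `e^⊥`, in the direction of the unit vector `e`. -/
def HasLipschitzBoundary {d : ℕ} (D : Set (E d)) : Prop :=
  ∀ x₀ ∈ frontier D, ∃ (r : ℝ) (e : E d) (K : NNReal) (γ : (Submodule.span ℝ {e})ᗮ → ℝ),
    0 < r ∧ ‖e‖ = 1 ∧ LipschitzWith K γ ∧
    ∀ x ∈ Metric.ball x₀ r,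
      x ∈ D ↔ inner ℝ e x < γ ((Submodule.span ℝ {e})ᗮ.orthogonalProjectionOnto x)

/-- A bounded, connected (hence non-empty) open set of `ℝ^d` with Lipschitz boundary. -/
structure LipDomain (d : ℕ) where
  carrier : Set (E d)
  isOpen : IsOpen carrier
  isConnected : IsConnected carrier
  isBounded : Bornology.IsBounded carrier
  lipschitzBoundary : HasLipschitzBoundary carrier

variable {d : ℕ}

/-- Lebesgue measure on `D`. -/
abbrev LipDomain.vol (D : LipDomain d) : Measure (E d) := volume.restrict D.carrier

instance (D : LipDomain d) : IsFiniteMeasure D.vol :=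
  ⟨by simpa using D.isBounded.measure_lt_top⟩

/-! ### Sobolev spaces -/

/-- `φ ∈ C_c^∞(D)`. -/
structure IsTestFunction (D : LipDomain d) (φ : E d → ℝ) : Prop where
  smooth : ContDiff ℝ ∞ φ
  compact : HasCompactSupport φ
  supp : tsupport φ ⊆ D.carrier

/-- `p` is the weak gradient of `u` on `D`. -/
def IsWeakGradient (D : LipDomain d) (u : E d → ℝ) (p : E d → E d) : Prop :=
  ∀ φ : E d → ℝ, IsTestFunction D φ → ∀ v : E d,
    ∫ x, u x * fderiv ℝ φ x v ∂D.vol = -∫ x, inner ℝ (p x) v * φ x ∂D.vol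

/-- `L²(D)`. -/
abbrev L2 (D : LipDomain d) := Lp ℝ 2 D.vol

/-- `L²(D; ℝ^d)`. -/
abbrev L2vec (D : LipDomain d) := Lp (E d) 2 D.vol

lemma IsTestFunction.memLp {D : LipDomain d} {φ : E d → ℝ} (h : IsTestFunction D φ) :
    MemLp φ 2 D.vol :=
  (h.smooth.continuous.memLp_of_hasCompactSupport h.compact).mono_measure
    Measure.restrict_le_self

lemma IsTestFunction.memLp_fderiv {D : LipDomain d} {φ : E d → ℝ} (h : IsTestFunction D φ)
    (v : E d) : MemLp (fun x => fderiv ℝ φ x v) 2 D.vol := by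
  have hc : Continuous fun x => fderiv ℝ φ x v :=
    (h.smooth.continuous_fderiv (by simp)).clm_apply continuous_const
  exact (hc.memLp_of_hasCompactSupport (h.compact.fderiv_apply ℝ v)).mono_measure
    Measure.restrict_le_self

/-- The Sobolev space `H¹(D)`, realized as the space of pairs `(u, ∇u)` in
`L²(D) × L²(D; ℝ^d)`, with `‖u‖²_{H¹} = ‖u‖²_{L²} + ‖∇u‖²_{L²}`. -/
def H1 (D : LipDomain d) : Submodule ℝ (WithLp 2 (L2 D × L2vec D)) where
  carrier := {U | IsWeakGradient D U.fst U.snd}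
  zero_mem' := by
    intro φ hφ v
    have h1 : ∫ x, ((0 : L2 D) : E d → ℝ) x * fderiv ℝ φ x v ∂D.vol = 0 := by
      rw [integral_congr_ae (g := fun _ => 0)]
      · simp
      · filter_upwards [Lp.coeFn_zero ℝ 2 D.vol] with x hx
        rw [hx]
        simp
    have h2 : ∫ x, inner ℝ (((0 : L2vec D) : E d → E d) x) v * φ x ∂D.vol = 0 := by
      rw [integral_congr_ae (g := fun _ => 0)]
      · simp
      · filter_upwards [Lp.coeFn_zero (E d) 2 D.vol] with x hx
        rw [hx]
        simp
    exact h1.trans (neg_eq_zero.mpr h2).symm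
  add_mem' := by
    intro U W hU hW φ hφ v
    have e1 : ∫ x, ((U + W).fst : E d → ℝ) x * fderiv ℝ φ x v ∂D.vol
        = ∫ x, (U.fst : E d → ℝ) x * fderiv ℝ φ x v ∂D.vol
          + ∫ x, (W.fst : E d → ℝ) x * fderiv ℝ φ x v ∂D.vol := by
      refine Eq.trans ?_ (integral_add ((Lp.memLp U.fst).integrable_mul (hφ.memLp_fderiv v))
        ((Lp.memLp W.fst).integrable_mul (hφ.memLp_fderiv v)))
      apply integral_congr_ae
      filter_upwards [Lp.coeFn_add U.fst W.fst] with x hx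
      have hx' : ((U + W).fst : E d → ℝ) x
          = (U.fst : E d → ℝ) x + (W.fst : E d → ℝ) x := hx
      rw [hx', add_mul]
    have e2 : ∫ x, inner ℝ (((U + W).snd : E d → E d) x) v * φ x ∂D.vol
        = ∫ x, inner ℝ ((U.snd : E d → E d) x) v * φ x ∂D.vol
          + ∫ x, inner ℝ ((W.snd : E d → E d) x) v * φ x ∂D.vol := by
      refine Eq.trans ?_ (integral_add (((Lp.memLp U.snd).inner_const v).integrable_mul hφ.memLp)
        (((Lp.memLp W.snd).inner_const v).integrable_mul hφ.memLp))
      apply integral_congr_ae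
      filter_upwards [Lp.coeFn_add U.snd W.snd] with x hx
      have hx' : ((U + W).snd : E d → E d) x
          = (U.snd : E d → E d) x + (W.snd : E d → E d) x := hx
      rw [hx', inner_add_left, add_mul]
    rw [e1, e2, hU φ hφ v, hW φ hφ v]
    ring
  smul_mem' := by
    intro c U hU φ hφ v
    have e1 : ∫ x, ((c • U).fst : E d → ℝ) x * fderiv ℝ φ x v ∂D.vol
        = c * ∫ x, (U.fst : E d → ℝ) x * fderiv ℝ φ x v ∂D.vol := by
      rw [← integral_const_mul]
      apply integral_congr_ae
      filter_upwards [Lp.coeFn_smul c U.fst] with x hx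
      simp [hx, mul_assoc]
    have e2 : ∫ x, inner ℝ (((c • U).snd : E d → E d) x) v * φ x ∂D.vol
        = c * ∫ x, inner ℝ ((U.snd : E d → E d) x) v * φ x ∂D.vol := by
      rw [← integral_const_mul]
      apply integral_congr_ae
      filter_upwards [Lp.coeFn_smul c U.snd] with x hx
      simp [hx, mul_assoc, inner_smul_left]
    rw [e1, e2, hU φ hφ v]
    ring

/-- The function in `L²(D)` underlying an element of `H¹(D)`. -/
def toL2 (D : LipDomain d) : H1 D →L[ℝ] L2 D :=
  (WithLp.fstL 2 ℝ (L2 D) (L2vec D)).comp (H1 D).subtypeL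

/-- The (weak) gradient of an element of `H¹(D)`. -/
def grad (D : LipDomain d) : H1 D →L[ℝ] L2vec D :=
  (WithLp.sndL 2 ℝ (L2 D) (L2vec D)).comp (H1 D).subtypeL

/-- The constant function `1` in `L²(D)`. -/
def oneL2 (D : LipDomain d) : L2 D := (memLp_const (1 : ℝ)).toLp (fun _ => 1)

/-- The constant function `1` in `H¹(D)`, with gradient `0`. -/
def one (D : LipDomain d) : H1 D :=
  ⟨WithLp.toLp 2 (oneL2 D, 0), by
    intro φ hφ v
    have h1 : ∫ x, (oneL2 D : E d → ℝ) x * fderiv ℝ φ x v ∂D.vol = 0 := by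
      have h0 : ∫ x, fderiv ℝ φ x v = 0 := by
        have hd : Differentiable ℝ φ := hφ.smooth.differentiable (by simp)
        have hi : Integrable fun x => fderiv ℝ φ x v :=
          ((hφ.smooth.continuous_fderiv (by simp)).clm_apply
            continuous_const).integrable_of_hasCompactSupport (hφ.compact.fderiv_apply ℝ v)
        have h := integral_mul_fderiv_eq_neg_fderiv_mul_of_integrable (μ := volume)
          (f := fun _ : E d => (1 : ℝ)) (g := φ) (v := v)
          (by simp) (by simpa using hi)
          (by simpa using hφ.smooth.continuous.integrable_of_hasCompactSupport hφ.compact)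
          (fun _ _ => by fun_prop) (fun x _ => hd x)
        simpa using h
      have hs : ∫ x, fderiv ℝ φ x v ∂D.vol = ∫ x, fderiv ℝ φ x v := by
        apply setIntegral_eq_integral_of_forall_compl_eq_zero
        intro x hx
        have : x ∉ tsupport φ := fun h => hx (hφ.supp h)
        have h2 : fderiv ℝ φ x = 0 := by
          by_contra hne
          exact this (support_fderiv_subset ℝ hne)
        simp [h2]
      rw [← h0, ← hs]
      apply integral_congr_ae
      filter_upwards [MemLp.coeFn_toLp (memLp_const (1 : ℝ) (p := 2) (μ := D.vol))] with x hx
      simp only [oneL2]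
      rw [hx, one_mul]
    have h2 : ∫ x, inner ℝ (((0 : L2vec D) : E d → E d) x) v * φ x ∂D.vol = 0 := by
      rw [integral_congr_ae (g := fun _ => 0)]
      · simp
      · filter_upwards [Lp.coeFn_zero (E d) 2 D.vol] with x hx
        rw [hx]
        simp
    exact h1.trans (neg_eq_zero.mpr h2).symm⟩

/-- `H¹₀(D)`: the closure of `C_c^∞(D)` in `H¹(D)`. -/
def H10 (D : LipDomain d) : Submodule ℝ (H1 D) :=
  (Submodule.span ℝ
    {U : H1 D | ∃ φ, IsTestFunction D φ ∧ (toL2 D U : E d → ℝ) =ᵐ[D.vol] φ}).topologicalClosure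

/-- `H¹(D)^*`; the duality pairing `⟨ℓ, J⟩` is the application `ℓ J`. -/
abbrev H1Dual (D : LipDomain d) := StrongDual ℝ (H1 D)

/-- The embedding `L²(D) ⊂ H¹(D)^*`, `⟨f, J⟩ = (f, J)_{L²(D)}`. -/
def ofL2 (D : LipDomain d) (f : L2 D) : H1Dual D := (innerSL ℝ f).comp (toL2 D)

/-- The embedding `H¹(D) ⊂ L²(D) ⊂ H¹(D)^*`. -/
def ofH1 (D : LipDomain d) (U : H1 D) : H1Dual D := ofL2 D (toL2 D U)

/-- `H = {h ∈ H¹(D)^* ; ⟨h, 1⟩ = 0}`. -/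
def Hspace (D : LipDomain d) : Submodule ℝ (H1Dual D) where
  carrier := {ℓ | ℓ (one D) = 0}
  zero_mem' := by simp
  add_mem' := by
    intro a b ha hb
    simp only [Set.mem_ofPred_eq] at *
    simp [ha, hb]
  smul_mem' := by
    intro c a ha
    simp only [Set.mem_ofPred_eq] at *
    simp [ha]

/-- `g` solves the Neumann problem `(∇g, ∇J) = ⟨ℓ, J⟩` for all `J ∈ H¹(D)`, `(g, 1) = 0`. -/
def IsGreenPotential (D : LipDomain d) (ℓ : H1Dual D) (g : H1 D) : Prop :=
  (∀ J : H1 D, inner ℝ (grad D g) (grad D J) = ℓ J) ∧ inner ℝ (toL2 D g) (oneL2 D) = 0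

open Classical in
/-- The Green operator `G` of the Laplacian with zero Neumann boundary condition: for `ℓ ∈ H`,
`G ℓ` is the unique solution of the Neumann problem (`0` by convention if there is none, which
does not occur for `ℓ ∈ H`). -/
def green (D : LipDomain d) (ℓ : H1Dual D) : H1 D :=
  if h : ∃ g, IsGreenPotential D ℓ g then h.choose else 0

/-- The inner product `(h₁, h₂)_H = (∇ G h₁, ∇ G h₂)_{L²(D)}` on `H`. -/
def innerH (D : LipDomain d) (h₁ h₂ : H1Dual D) : ℝ :=
  inner ℝ (grad D (green D h₁)) (grad D (green D h₂))

/-- The norm `‖h‖_H = (h, h)_H^{1/2}` on `H`. -/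
def normH (D : LipDomain d) (h : H1Dual D) : ℝ := Real.sqrt (innerH D h h)

/-- `V = {v ∈ H¹₀(D) ; ∫_D v = 0}`, with the norm of `H¹(D)`. -/
def Vspace (D : LipDomain d) : Submodule ℝ (H1 D) where
  carrier := {U | U ∈ H10 D ∧ ofH1 D U ∈ Hspace D}
  zero_mem' := ⟨zero_mem _, by simp [ofH1, ofL2]⟩
  add_mem' := by
    intro a b ha hb
    refine ⟨add_mem ha.1 hb.1, ?_⟩
    have h : ofH1 D (a + b) = ofH1 D a + ofH1 D b := by simp [ofH1, ofL2, map_add]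
    rw [h]
    exact add_mem ha.2 hb.2
  smul_mem' := by
    intro c a ha
    refine ⟨Submodule.smul_mem _ c ha.1, ?_⟩
    have h : ofH1 D (c • a) = c • ofH1 D a := by simp [ofH1, ofL2]
    rw [h]
    exact Submodule.smul_mem _ c ha.2

/-- `V^*`. -/
abbrev VDual (D : LipDomain d) := StrongDual ℝ (Vspace D)

/-! ### The macroscopic equation `∂ₜ h = -Δ div (∇σ(∇h))`, `h = 0` outside `D` -/

/-- `F ∈ V^*` is the image of `ℓ ∈ H` under `H = H^* ⊂ V^*`: `⟨F, g⟩ = (ℓ, g)_H` for `g ∈ V`. -/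
def IsImageInVDual (D : LipDomain d) (ℓ : H1Dual D) (F : VDual D) : Prop :=
  ∀ g : Vspace D, F g = innerH D ℓ (ofH1 D g)

/-- `F ∈ V^*` is `A_f(v) = -Δ div (∇σ(∇v + ∇f))`. Because of the form of the embedding of `H` into
`V^*`, this means that `⟨F, g⟩ = -(∇σ(∇v + ∇f), ∇g)_{L²(D)}` for all `g ∈ V`. -/
def IsOperatorValue (D : LipDomain d) (σ : E d → ℝ) (f : H1 D) (v : Vspace D) (F : VDual D) :
    Prop :=
  ∀ g : Vspace D, F g =
    -∫ x, inner ℝ (gradient σ ((grad D v : E d → E d) x + (grad D f : E d → E d) x))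
      ((grad D g : E d → E d) x) ∂D.vol

/-- Lebesgue measure on the time interval `[0, T]`. -/
abbrev timeVol (T : ℝ) : Measure ℝ := volume.restrict (Set.Icc 0 T)

/-- `h : [0, T] → H¹(D)^*` is a solution on `[0, T]` of the macroscopic equation with surface
tension `σ` and initial datum `h₀ ∈ H¹(D)^*`. The values of `h` outside `[0, T]` are irrelevant.
Here `v` is `h_f = h - f` as a function with values in `V`, and `F` is `h_f` as a function with
values in `V^*`, with derivative `F'`. -/
def IsSolutionOn (D : LipDomain d) (σ : E d → ℝ) (T : ℝ) (h₀ : H1Dual D) (h : ℝ → H1Dual D) :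
    Prop :=
  ∃ f ∈ H10 D,
    -- the auxiliary function has the volume of the initial datum
    h₀ (one D) = ofH1 D f (one D) ∧
    -- `h_f ∈ C([0, T]; H)`
    (∀ t ∈ Set.Icc 0 T, h t - ofH1 D f ∈ Hspace D) ∧
    ContinuousOn (fun t => h t - ofH1 D f) (Set.Icc 0 T) ∧
    -- `h_f(0) = h₀ - f`
    h 0 - ofH1 D f = h₀ - ofH1 D f ∧
    -- `h_f ∈ L²(0, T; V)`
    ∃ v : ℝ → Vspace D, MemLp v 2 (timeVol T) ∧
      (∀ᵐ t ∂timeVol T, h t - ofH1 D f = ofH1 D (v t)) ∧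
      -- `h_f : [0, T] → V^*` is absolutely continuous and in `W^{1,2}([0, T], V^*)`
      ∃ F F' : ℝ → VDual D,
        (∀ t ∈ Set.Icc 0 T, IsImageInVDual D (h t - ofH1 D f) (F t)) ∧
        AbsolutelyContinuousOnInterval F 0 T ∧
        (∀ᵐ t ∂timeVol T, HasDerivAt F (F' t) t) ∧
        MemLp F' 2 (timeVol T) ∧
        -- `d/dt h_f = A_f(h_f(t))` in `V^*` for almost every `t`
        ∀ᵐ t ∂timeVol T, IsOperatorValue D σ f (v t) (F' t)

/-- `h : [0, ∞) → H¹(D)^*` is a (global) solution: it is a solution on every `[0, T]`. -/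
def IsSolution (D : LipDomain d) (σ : E d → ℝ) (h₀ : H1Dual D) (h : ℝ → H1Dual D) : Prop :=
  ∀ T : ℝ, 0 < T → IsSolutionOn D σ T h₀ h

end SurfaceDiffusion

end

/-! For two solutions put `w = h - k`. Formally, half the time derivative of `‖w‖_H²` is `⟨∂ₜw, w⟩ =
-(∇σ(∇h) - ∇σ(∇k), ∇h - ∇k)`, which is nonpositive because the gradient of a convex function is
monotone. The auxiliary functions `f₁`, `f₂` of the two solutions may differ, but the equal volumes
put `f₁ - f₂` into `Vspace`, so `w(t)` comes from an element of `Vspace` for almost every `t` and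
may be used as a test function. Three points need work.

Surface tension. The energy is jointly convex in the field and the tilt, so by Prékopa–Leindler the
partition function is log-concave in the tilt and `σ` is convex (`IsSurfaceTension.convexOn`). The
upper bound on `V''` and the Cauchy–Schwarz inequality bound second differences of `σ` from above
(`IsSurfaceTension.exists_midpoint_le`). Together these make `σ` differentiable with a gradient of
linear growth, so that `gradient` and the integrals in `IsOperatorValue` are not default values.

Green operator. `green` is meaningful on `H` only if the Neumann problem is solvable. This follows
from Lax–Milgram and the Poincaré inequality `exists_poincare`, proved by comparing a function with
its averages along chains of mutually visible subsets of `D`.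

Chain rule. No differentiability of `‖w‖_H²` is established. The inequality `‖a‖² - ‖b‖² ≤ 2 (a - b,
a)` controls its left difference quotients by the pairing of increments in the dual of `Vspace` with
the fixed vector `w(t)`, and a Fatou argument (`le_of_left_slope_le`) turns an almost everywhere
sign into monotonicity. -/

namespace SurfaceDiffusion

/-! ### The Prékopa–Leindler inequality. -/

open scoped Pointwise in
/-- The one-dimensional Brunn–Minkowski inequality. -/
lemma volume_add_volume_le_volume_add {A B : Set ℝ} (hA : MeasurableSet A) (hB : MeasurableSet B)
    (hA0 : A.Nonempty) (hB0 : B.Nonempty) : volume A + volume B ≤ volume (A + B) := by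
  have key : ∀ K L : Set ℝ, IsCompact K → IsCompact L → K.Nonempty → L.Nonempty →
      volume K + volume L ≤ volume (K + L) := by
    intro K L hK hL hK0 hL0
    have hm := hK.sSup_mem hK0
    have hl := hL.sInf_mem hL0
    set a := sSup K
    set b := sInf L
    -- With `a = max K` and `b = min L`, the first translate lies to the left of `a + b` and the
    -- second to the right.
    have h1 : (b +ᵥ K) ∪ (a +ᵥ L) ⊆ K + L := by
      rintro x (⟨y, hy, rfl⟩ | ⟨y, hy, rfl⟩)
      · exact ⟨y, hy, b, hl, by simp [add_comm]⟩
      · exact ⟨a, hm, y, hy, by simp⟩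
    have h2 : AEDisjoint volume (b +ᵥ K) (a +ᵥ L) := by
      refine measure_mono_null (t := {a + b}) ?_ (by simp)
      rintro x ⟨⟨y, hy, rfl⟩, ⟨z, hz, hzx⟩⟩
      have e1 : y ≤ a := le_csSup hK.bddAbove hy
      have e2 : b ≤ z := csInf_le hL.bddBelow hz
      simp only [vadd_eq_add] at hzx
      simp only [vadd_eq_add, Set.mem_singleton_iff]
      linarith
    calc volume K + volume L = volume (b +ᵥ K) + volume (a +ᵥ L) := by
          rw [measure_vadd, measure_vadd]
      _ = volume ((b +ᵥ K) ∪ (a +ᵥ L)) :=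
          (measure_union₀ (hL.measurableSet.const_vadd a).nullMeasurableSet h2).symm
      _ ≤ _ := measure_mono h1
  have mono : ∀ K ⊆ A, IsCompact K → ∀ L ⊆ B, IsCompact L →
      volume K + volume L ≤ volume (A + B) := by
    intro K hKA hK L hLB hL
    obtain ⟨a, ha⟩ := hA0
    obtain ⟨b, hb⟩ := hB0
    -- An approximating compact set may be empty; adding one point keeps the sum set nonempty.
    calc volume K + volume L ≤ volume (K ∪ {a}) + volume (L ∪ {b}) := by
          gcongr <;> exact Set.subset_union_left
      _ ≤ volume ((K ∪ {a}) + (L ∪ {b})) := key _ _ (hK.union isCompact_singleton)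
          (hL.union isCompact_singleton) (by simp) (by simp)
      _ ≤ _ := measure_mono (Set.add_subset_add (by simp [hKA, ha, Set.insert_subset_iff])
          (by simp [hLB, hb, Set.insert_subset_iff]))
  have sup : ∀ {S : Set ℝ}, MeasurableSet S →
      volume S = ⨆ (K : Set ℝ) (_ : K ⊆ S ∧ IsCompact K), volume K := by
    intro S hS
    simp only [hS.measure_eq_iSup_isCompact, iSup_and]
  rw [sup hA, sup hB]
  exact ENNReal.biSup_add_biSup_le' ⟨∅, by simp⟩ ⟨∅, by simp⟩
    fun K hK L hL => mono K hK.1 hK.2 L hL.1 hL.2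

open scoped Pointwise in
/-- The Prékopa–Leindler inequality on `ℝ` for functions with values and supremum equal to `1`. -/
lemma prekopaLeindler_normalized {s t : ℝ} (hs : 0 < s) (ht : 0 < t) {F G H : ℝ → ℝ}
    (hF : Measurable F) (hG : Measurable G) (hH : Measurable H)
    (hF0 : ∀ x, 0 ≤ F x) (hG0 : ∀ x, 0 ≤ G x) (hH0 : ∀ x, 0 ≤ H x)
    (hF1 : ∀ x, F x ≤ 1) (hG1 : ∀ x, G x ≤ 1)
    (hFs : ∀ r < 1, ∃ x, r < F x) (hGs : ∀ r < 1, ∃ x, r < G x)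
    (h : ∀ x y r, 0 < r → r < F x → r < G y → r < H (s * x + t * y)) :
    ENNReal.ofReal s * (∫⁻ x, ENNReal.ofReal (F x)) + ENNReal.ofReal t *
      (∫⁻ x, ENNReal.ofReal (G x)) ≤ ∫⁻ x, ENNReal.ofReal (H x) := by
  have lc : ∀ K : ℝ → ℝ, Measurable K → (∀ x, 0 ≤ K x) →
      ∫⁻ x, ENNReal.ofReal (K x) = ∫⁻ r in Set.Ioi 0, volume {x | r < K x} :=
    fun K hK hK0 => lintegral_eq_lintegral_meas_lt volume (Eventually.of_forall hK0) hK.aemeasurable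
  have meas : ∀ K : ℝ → ℝ, Measurable fun r => volume {x | r < K x} := fun K =>
    Antitone.measurable fun a b hab => measure_mono fun x hx => lt_of_le_of_lt hab hx
  rw [lc F hF hF0, lc G hG hG0, lc H hH hH0,
    ← lintegral_const_mul' _ _ (by simp), ← lintegral_const_mul' _ _ (by simp),
    ← lintegral_add_left (.const_mul (meas F) _)]
  refine setLIntegral_mono' measurableSet_Ioi fun r hr => ?_
  rcases lt_or_ge r 1 with hr1 | hr1
  -- Below height 1 both superlevel sets are nonempty, as Brunn–Minkowski requires; from height 1 on
  -- both are empty. This is why the suprema are normalized.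
  · have sm : ∀ c : ℝ, 0 < c → ∀ A : Set ℝ, volume (c • A) = ENNReal.ofReal c * volume A := by
      intro c hc A
      rw [Measure.addHaar_smul]
      simp [abs_of_pos hc]
    have mA : MeasurableSet {x | r < F x} := measurableSet_lt measurable_const hF
    have mB : MeasurableSet {x | r < G x} := measurableSet_lt measurable_const hG
    rw [← sm s hs, ← sm t ht]
    refine (volume_add_volume_le_volume_add (mA.const_smul₀ s) (mB.const_smul₀ t)
      (Set.Nonempty.smul_set (hFs r hr1)) (Set.Nonempty.smul_set (hGs r hr1))).trans
      (measure_mono ?_)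
    rintro _ ⟨_, ⟨x, hx, rfl⟩, _, ⟨y, hy, rfl⟩, rfl⟩
    exact h x y r hr hx hy
  · have e1 : {x | r < F x} = ∅ := by
      ext x; simpa using (hF1 x).trans hr1
    have e2 : {x | r < G x} = ∅ := by
      ext x; simpa using (hG1 x).trans hr1
    simp [e1, e2]

lemma ennreal_geom_mean_le_arith_mean {s t : ℝ} (hs : 0 < s) (ht : 0 < t) (hst : s + t = 1)
    (a b : ENNReal) : a ^ s * b ^ t ≤ ENNReal.ofReal s * a + ENNReal.ofReal t * b := by
  rcases eq_or_ne a ⊤ with rfl | ha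
  · simp [ENNReal.mul_top, hs]
  rcases eq_or_ne b ⊤ with rfl | hb
  · simp [ENNReal.mul_top, ht]
  lift a to NNReal using ha
  lift b to NNReal using hb
  have := NNReal.geom_mean_le_arith_mean2_weighted s.toNNReal t.toNNReal a b
    (by rw [← Real.toNNReal_add hs.le ht.le, hst, Real.toNNReal_one])
  rw [Real.coe_toNNReal _ hs.le, Real.coe_toNNReal _ ht.le] at this
  rw [← ENNReal.coe_rpow_of_nonneg _ hs.le, ← ENNReal.coe_rpow_of_nonneg _ ht.le]
  simp only [ENNReal.ofReal]
  exact_mod_cast this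

/-- The Prékopa–Leindler inequality on `ℝ` for bounded functions. -/
lemma prekopaLeindler_bounded {s t : ℝ} (hs : 0 < s) (ht : 0 < t) (hst : s + t = 1)
    {f g h : ℝ → ENNReal} (hf : Measurable f) (hg : Measurable g) (hh : Measurable h)
    (hfb : ⨆ x, f x ≠ ⊤) (hgb : ⨆ x, g x ≠ ⊤)
    (H : ∀ x y, f x ^ s * g y ^ t ≤ h (s * x + t * y)) :
    (∫⁻ x, f x) ^ s * (∫⁻ x, g x) ^ t ≤ ∫⁻ x, h x := by
  set M := ⨆ x, f x
  set N := ⨆ x, g x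
  have hfM : ∀ x, f x ≤ M := le_iSup f
  have hgN : ∀ x, g x ≤ N := le_iSup g
  rcases eq_or_ne M 0 with hM | hM
  · have : ∀ x, f x = 0 := fun x => le_antisymm ((hfM x).trans hM.le) zero_le
    simp [this, ENNReal.zero_rpow_of_pos hs]
  rcases eq_or_ne N 0 with hN | hN
  · have : ∀ x, g x = 0 := fun x => le_antisymm ((hgN x).trans hN.le) zero_le
    simp [this, ENNReal.zero_rpow_of_pos ht]
  set c := M ^ s * N ^ t
  have hMs0 : M ^ s ≠ 0 := by simp [ENNReal.rpow_eq_zero_iff, hM, hfb]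
  have hNt0 : N ^ t ≠ 0 := by simp [ENNReal.rpow_eq_zero_iff, hN, hgb]
  have hMst : M ^ s ≠ ⊤ := ENNReal.rpow_ne_top_of_nonneg hs.le hfb
  have hNtt : N ^ t ≠ ⊤ := ENNReal.rpow_ne_top_of_nonneg ht.le hgb
  have hc0 : c ≠ 0 := mul_ne_zero hMs0 hNt0
  have hct : c ≠ ⊤ := ENNReal.mul_ne_top hMst hNtt
  have hdiv : ∀ a b : ENNReal, (a / M) ^ s * (b / N) ^ t = a ^ s * b ^ t / c := by
    intro a b
    rw [ENNReal.div_rpow_of_nonneg _ _ hs.le, ENNReal.div_rpow_of_nonneg _ _ ht.le,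
      div_eq_mul_inv, div_eq_mul_inv, div_eq_mul_inv,
      ENNReal.mul_inv (Or.inl hMs0) (Or.inl hMst)]
    ring
  have nf : ∀ x, f x / M ≤ 1 := fun x => ENNReal.div_le_of_le_mul (by simpa using hfM x)
  have ng : ∀ x, g x / N ≤ 1 := fun x => ENNReal.div_le_of_le_mul (by simpa using hgN x)
  have top1 : ∀ {a : ENNReal}, a ≤ 1 → a ≠ ⊤ := fun h => ne_top_of_le_ne_top (by simp) h
  have sup1 : ∀ {k : ℝ → ENNReal} {K : ENNReal}, K = ⨆ x, k x → K ≠ 0 → K ≠ ⊤ →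
      (∀ x, k x / K ≤ 1) → ∀ r < 1, ∃ x, r < (k x / K).toReal := by
    intro k K hk hK0 hKt hk1 r hr
    have : ENNReal.ofReal (max r 0) * K < ⨆ x, k x := by
      rw [← hk]
      conv_rhs => rw [← one_mul K]
      exact (ENNReal.mul_lt_mul_iff_left hK0 hKt).mpr (by simpa using hr)
    obtain ⟨x, hx⟩ := lt_iSup_iff.mp this
    exact ⟨x, (le_max_left r 0).trans_lt ((ENNReal.ofReal_lt_iff_lt_toReal (le_max_right _ _)
      (top1 (hk1 x))).mp ((ENNReal.lt_div_iff_mul_lt (Or.inl hK0) (Or.inl hKt)).mpr hx))⟩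
  -- `h` may take the value `⊤`, which `toReal` sends to 0. Truncating at 1 avoids this and costs
  -- nothing, since the normalized `f` and `g` are at most 1.
  have main := prekopaLeindler_normalized hs ht (F := fun x => (f x / M).toReal)
    (G := fun x => (g x / N).toReal) (H := fun x => (min (h x / c) 1).toReal)
    (hf.div_const _).ennreal_toReal (hg.div_const _).ennreal_toReal
    ((hh.div_const _).min measurable_const).ennreal_toReal
    (fun _ => ENNReal.toReal_nonneg) (fun _ => ENNReal.toReal_nonneg)
    (fun _ => ENNReal.toReal_nonneg)
    (fun x => ENNReal.toReal_le_of_le_ofReal zero_le_one (by simpa using nf x))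
    (fun x => ENNReal.toReal_le_of_le_ofReal zero_le_one (by simpa using ng x))
    (sup1 rfl hM hfb nf) (sup1 rfl hN hgb ng) ?_
  · simp only [ENNReal.ofReal_toReal (top1 (nf _)), ENNReal.ofReal_toReal (top1 (ng _)),
      ENNReal.ofReal_toReal (top1 (min_le_right _ 1))] at main
    have am := (ennreal_geom_mean_le_arith_mean hs ht hst _ _).trans main
    simp only [div_eq_mul_inv] at am
    rw [lintegral_mul_const _ hf, lintegral_mul_const _ hg, ← div_eq_mul_inv, ← div_eq_mul_inv,
      hdiv] at am
    have h2 : ∫⁻ x, min (h x * c⁻¹) 1 ≤ (∫⁻ x, h x) / c := by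
      rw [div_eq_mul_inv, ← lintegral_mul_const _ hh]
      exact lintegral_mono fun x => min_le_left _ _
    have h3 := (ENNReal.div_le_iff hc0 hct).mp (am.trans h2)
    rwa [ENNReal.div_mul_cancel hc0 hct] at h3
  · intro x y r hr hx hy
    have hx' := (ENNReal.ofReal_lt_iff_lt_toReal hr.le (top1 (nf x))).mpr hx
    have hy' := (ENNReal.ofReal_lt_iff_lt_toReal hr.le (top1 (ng y))).mpr hy
    refine (ENNReal.ofReal_lt_iff_lt_toReal hr.le (top1 (min_le_right _ 1))).mp (lt_min ?_ 
      (hx'.trans_le (nf x)))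
    calc ENNReal.ofReal r = ENNReal.ofReal r ^ s * ENNReal.ofReal r ^ t := by
          rw [← ENNReal.rpow_add_of_nonneg _ _ hs.le ht.le, hst, ENNReal.rpow_one]
      _ < (f x / M) ^ s * (g y / N) ^ t :=
          ENNReal.mul_lt_mul (ENNReal.rpow_lt_rpow hx' hs) (ENNReal.rpow_lt_rpow hy' ht)
      _ = f x ^ s * g y ^ t / c := hdiv _ _
      _ ≤ _ := by gcongr; exact H x y

/-- The Prékopa–Leindler inequality on `ℝ`. -/
lemma prekopaLeindler_real {s t : ℝ} (hs : 0 < s) (ht : 0 < t) (hst : s + t = 1)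
    {f g h : ℝ → ENNReal} (hf : Measurable f) (hg : Measurable g) (hh : Measurable h)
    (H : ∀ x y, f x ^ s * g y ^ t ≤ h (s * x + t * y)) :
    (∫⁻ x, f x) ^ s * (∫⁻ x, g x) ^ t ≤ ∫⁻ x, h x := by
  have tr : ∀ k : ℝ → ENNReal, Measurable k →
      Tendsto (fun n : ℕ => ∫⁻ x, min (k x) n) atTop (𝓝 (∫⁻ x, k x)) := by
    intro k hk
    refine lintegral_tendsto_of_tendsto_of_monotone (fun n => (hk.min measurable_const).aemeasurable)
      (ae_of_all _ fun x m n hmn => min_le_min_left _ (by exact_mod_cast hmn))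
      (ae_of_all _ fun x => ?_)
    simpa using (tendsto_const_nhds (x := k x)).min ENNReal.tendsto_nat_nhds_top
  have bd : ∀ (k : ℝ → ENNReal) (n : ℕ), ⨆ x, min (k x) n ≠ ⊤ := fun k n =>
    ne_top_of_le_ne_top (ENNReal.natCast_ne_top n) (iSup_le fun x => min_le_right _ _)
  have key : ∀ n : ℕ, (∫⁻ x, min (f x) n) ^ s * (∫⁻ x, min (g x) n) ^ t ≤ ∫⁻ x, h x := fun n =>
    prekopaLeindler_bounded hs ht hst (hf.min measurable_const) (hg.min measurable_const) hh
      (bd f n) (bd g n) fun x y => (H x y).trans' (by gcongr <;> exact min_le_left _ _)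
  -- Independent truncation levels allow the supremum to be taken in each factor separately.
  have key2 : ∀ m n : ℕ, (∫⁻ x, min (f x) m) ^ s * (∫⁻ x, min (g x) n) ^ t ≤ ∫⁻ x, h x := by
    intro m n
    refine (key (max m n)).trans' ?_
    gcongr <;> simp
  have sup : ∀ {k : ℝ → ENNReal} {r : ℝ}, Measurable k → 0 < r →
      (∫⁻ x, k x) ^ r = ⨆ n : ℕ, (∫⁻ x, min (k x) n) ^ r := by
    intro k r hk hr
    rw [← ENNReal.orderIsoRpow_apply r hr, tendsto_nhds_unique (tr k hk)
      (tendsto_atTop_iSup fun m n hmn => lintegral_mono fun x =>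
        min_le_min_left _ (by exact_mod_cast hmn)), OrderIso.map_iSup]
    rfl
  rw [sup hf hs, sup hg ht]
  simp only [ENNReal.iSup_mul, ENNReal.mul_iSup, iSup_le_iff]
  exact fun m n => key2 n m

/-- The Prékopa–Leindler inequality on `ℝⁿ`. -/
lemma prekopaLeindler_fin {s t : ℝ} (hs : 0 < s) (ht : 0 < t) (hst : s + t = 1) (n : ℕ)
    {f g h : (Fin n → ℝ) → ENNReal} (hf : Measurable f) (hg : Measurable g) (hh : Measurable h)
    (H : ∀ x y, f x ^ s * g y ^ t ≤ h (s • x + t • y)) :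
    (∫⁻ x, f x) ^ s * (∫⁻ x, g x) ^ t ≤ ∫⁻ x, h x := by
  induction n with
  | zero =>
    have e : ∀ k : (Fin 0 → ℝ) → ENNReal, ∫⁻ x, k x = k 0 := by
      intro k
      rw [volume_pi, Measure.pi_of_empty (x := (0 : Fin 0 → ℝ)), lintegral_dirac]
    have h0 : s • (0 : Fin 0 → ℝ) + t • 0 = 0 := Subsingleton.elim _ _
    rw [e, e, e, ← congrArg h h0]
    exact H 0 0
  | succ n ih =>
    have e : ∀ k : (Fin (n + 1) → ℝ) → ENNReal, Measurable k →
        ∫⁻ x, k x = ∫⁻ a : ℝ, ∫⁻ x : Fin n → ℝ, k (Fin.cons a x) := by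
      intro k hk
      rw [← ((volume_preserving_piFinSuccAbove (fun _ => ℝ) 0).symm).lintegral_comp hk,
        Measure.volume_eq_prod, lintegral_prod]
      · simp [MeasurableEquiv.piFinSuccAbove_symm_apply, Fin.insertNthEquiv]
      · exact (hk.comp (MeasurableEquiv.measurable _)).aemeasurable
    have mc : ∀ a : ℝ, Measurable fun x : Fin n → ℝ => (Fin.cons a x : Fin (n + 1) → ℝ) := by
      intro a
      refine measurable_pi_lambda _ fun i => ?_
      refine Fin.cases ?_ (fun j => ?_) i <;> simp <;> fun_prop
    have mc2 : Measurable fun p : ℝ × (Fin n → ℝ) => (Fin.cons p.1 p.2 : Fin (n + 1) → ℝ) := by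
      refine measurable_pi_lambda _ fun i => ?_
      refine Fin.cases ?_ (fun j => ?_) i <;> simp <;> fun_prop
    rw [e f hf, e g hg, e h hh]
    -- The inequality for the `n`-dimensional slices is the hypothesis of the one-dimensional
    -- inequality for the marginals.
    refine prekopaLeindler_real hs ht hst (hf.comp mc2).lintegral_prod_right'
      (hg.comp mc2).lintegral_prod_right' (hh.comp mc2).lintegral_prod_right' fun a b => ?_
    refine ih (hf.comp (mc a)) (hg.comp (mc b)) (hh.comp (mc _)) fun x y => ?_
    have : (Fin.cons (s * a + t * b) (s • x + t • y) : Fin (n + 1) → ℝ)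
        = s • Fin.cons a x + t • Fin.cons b y := by
      ext i
      refine Fin.cases ?_ (fun j => ?_) i <;> simp
    simpa [this] using H (Fin.cons a x) (Fin.cons b y)

/-- The Prékopa–Leindler inequality on a finite power of `ℝ`. -/
theorem prekopaLeindler {ι : Type*} [Fintype ι] {s t : ℝ} (hs : 0 < s) (ht : 0 < t)
    (hst : s + t = 1) {f g h : (ι → ℝ) → ENNReal} (hf : Measurable f) (hg : Measurable g)
    (hh : Measurable h) (H : ∀ x y, f x ^ s * g y ^ t ≤ h (s • x + t • y)) :
    (∫⁻ x, f x) ^ s * (∫⁻ x, g x) ^ t ≤ ∫⁻ x, h x := by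
  have mp := volume_measurePreserving_piCongrLeft (fun _ => ℝ) (Fintype.equivFin ι).symm
  have m := (MeasurableEquiv.piCongrLeft (fun _ => ℝ) (Fintype.equivFin ι).symm).measurable
  rw [← mp.lintegral_comp hf, ← mp.lintegral_comp hg, ← mp.lintegral_comp hh]
  refine prekopaLeindler_fin hs ht hst _ (hf.comp m) (hg.comp m) (hh.comp m) fun x y => ?_
  refine (H _ _).trans (le_of_eq (congrArg h ?_))
  ext i
  obtain ⟨j, rfl⟩ := (Fintype.equivFin ι).symm.surjective i
  simp [MeasurableEquiv.coe_piCongrLeft, Equiv.piCongrLeft_apply_apply]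


variable {d : ℕ}

/-! ### Quadratic bounds on the potential. -/

section Potential

variable {V : ℝ → ℝ}

lemma IsPotential.differentiable (hV : IsPotential V) : Differentiable ℝ V :=
  hV.contDiff.differentiable (by simp)

lemma IsPotential.differentiable_deriv (hV : IsPotential V) : Differentiable ℝ (deriv V) := by
  have h : ContDiff ℝ (1 + 1) V := by simpa [one_add_one_eq_two] using hV.contDiff
  exact (contDiff_succ_iff_deriv.mp h).2.2.differentiable (by simp)

lemma deriv2_const_mul_sq (c η : ℝ) : deriv (deriv fun x : ℝ => c / 2 * x ^ 2) η = c := by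
  have h : (deriv fun x : ℝ => c / 2 * x ^ 2) = fun x => c * x := by
    ext x
    simp
    ring
  rw [h]
  simp

/-- If `g'' ≥ f''` then `g - f` is convex. -/
lemma convexOn_sub_of_deriv2_le {f g : ℝ → ℝ} (hf : Differentiable ℝ f)
    (hf' : Differentiable ℝ (deriv f)) (hg : Differentiable ℝ g) (hg' : Differentiable ℝ (deriv g))
    (h : ∀ x, deriv (deriv f) x ≤ deriv (deriv g) x) :
    ConvexOn ℝ Set.univ fun x => g x - f x := by
  have e : deriv (fun x => g x - f x) = fun x => deriv g x - deriv f x := by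
    ext x
    exact deriv_sub (hg x) (hf x)
  refine convexOn_univ_of_deriv2_nonneg (hg.sub hf) (e ▸ hg'.sub hf') fun x => ?_
  simp only [Function.iterate_succ, Function.iterate_zero, Function.comp_apply, id_eq]
  rw [e, deriv_fun_sub (hg' x) (hf' x)]
  linarith [h x]

lemma differentiable_deriv_const_mul_sq (c : ℝ) :
    Differentiable ℝ (deriv fun x : ℝ => c / 2 * x ^ 2) := by
  have h : ContDiff ℝ (1 + 1) fun x : ℝ => c / 2 * x ^ 2 := by fun_prop
  exact (contDiff_succ_iff_deriv.mp h).2.2.differentiable (by simp)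

/-- `V - (c₋/2) η²` is convex and even, hence minimal at 0. This growth makes the partition
functions finite. -/
lemma IsPotential.exists_quadratic_le (hV : IsPotential V) :
    ∃ c, 0 < c ∧ ∀ η, V 0 + c * η ^ 2 ≤ V η := by
  obtain ⟨cm, cp, hm, -, h⟩ := hV.elliptic
  refine ⟨cm / 2, by positivity, fun η => ?_⟩
  have hc := convexOn_sub_of_deriv2_le (by fun_prop) (differentiable_deriv_const_mul_sq cm)
    hV.differentiable hV.differentiable_deriv fun x => by
      rw [deriv2_const_mul_sq]; exact (h x).1
  have := hc.2 (Set.mem_univ η) (Set.mem_univ (-η))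
    (by norm_num : (0 : ℝ) ≤ 1 / 2) (by norm_num : (0 : ℝ) ≤ 1 / 2) (by norm_num)
  simp [hV.even] at this
  linarith

/-- This is midpoint convexity of `(c₊/2) η² - V`. The same form of bound will pass to `σ`. -/
lemma IsPotential.exists_midpoint_le (hV : IsPotential V) :
    ∃ c, 0 < c ∧ ∀ s r, V (s + r) + V (s - r) ≤ 2 * V s + c * r ^ 2 := by
  obtain ⟨cm, cp, -, hp, h⟩ := hV.elliptic
  refine ⟨cp, hp, fun s r => ?_⟩
  have hc := convexOn_sub_of_deriv2_le hV.differentiable hV.differentiable_deriv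
    (by fun_prop) (differentiable_deriv_const_mul_sq cp) fun x => by
      rw [deriv2_const_mul_sq]; exact (h x).2
  have := hc.2 (Set.mem_univ (s + r)) (Set.mem_univ (s - r))
    (by norm_num : (0 : ℝ) ≤ 1 / 2) (by norm_num : (0 : ℝ) ≤ 1 / 2) (by norm_num)
  have e : (1 / 2 : ℝ) * (s + r) + 1 / 2 * (s - r) = s := by ring
  simp only [smul_eq_mul, e] at this
  nlinarith

lemma IsPotential.convexOn (hV : IsPotential V) : ConvexOn ℝ Set.univ V := by
  obtain ⟨cm, cp, hm, -, h⟩ := hV.elliptic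
  refine convexOn_univ_of_deriv2_nonneg hV.differentiable hV.differentiable_deriv fun x => ?_
  exact hm.le.trans (h x).1

end Potential

/-! ### Bondwise estimates of the energy. -/

section Hamiltonian

open Classical in
/-- The weight of the bond `{x, y}`, `x ∈ Γ`, in `hamiltonian V Γ`. -/
noncomputable def bondWeight (Γ : Finset (Fin d → ℤ)) (y : Fin d → ℤ) : ℝ := if y ∈ Γ then 1 / 2 else 1

lemma bondWeight_nonneg (Γ : Finset (Fin d → ℤ)) (y : Fin d → ℤ) : 0 ≤ bondWeight Γ y := by
  unfold bondWeight; split_ifs <;> norm_num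

lemma half_le_bondWeight (Γ : Finset (Fin d → ℤ)) (y : Fin d → ℤ) : 1 / 2 ≤ bondWeight Γ y := by
  unfold bondWeight; split_ifs <;> norm_num

lemma bondWeight_le_one (Γ : Finset (Fin d → ℤ)) (y : Fin d → ℤ) : bondWeight Γ y ≤ 1 := by
  unfold bondWeight; split_ifs <;> norm_num

/-- An inner bond is met from both of its ends, hence the weight one half. A single weighted sum
lets inequalities for `V` be applied bond by bond. -/
lemma hamiltonian_eq (V : ℝ → ℝ) (Γ : Finset (Fin d → ℤ)) (φ : (Fin d → ℤ) → ℝ) :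
    hamiltonian V Γ φ = ∑ x ∈ Γ, ∑ y ∈ neighbors x, bondWeight Γ y * V (φ x - φ y) := by
  unfold hamiltonian
  rw [Finset.mul_sum, ← Finset.sum_add_distrib]
  refine Finset.sum_congr rfl fun x _ => ?_
  rw [← Finset.sum_filter_add_sum_filter_not (neighbors x) (fun y => y ∈ Γ), Finset.mul_sum]
  congr 1 <;> refine Finset.sum_congr rfl fun y hy => ?_ <;>
    simp [bondWeight, (Finset.mem_filter.mp hy).2]

/-- The total weight of the bonds touching `Γ`. -/
noncomputable def totalWeight (Γ : Finset (Fin d → ℤ)) : ℝ := ∑ x ∈ Γ, ∑ y ∈ neighbors x, bondWeight Γ y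

lemma card_neighbors_le (x : Fin d → ℤ) : (neighbors x).card ≤ 2 * d := by
  refine Finset.card_biUnion_le.trans ((Finset.sum_le_sum fun i _ => Finset.card_le_two).trans ?_)
  simp [mul_comm]

lemma totalWeight_cube_le (d N : ℕ) : totalWeight (cube d N) ≤ N ^ d * (2 * d) := by
  have h : ∀ x ∈ cube d N, ∑ y ∈ neighbors x, bondWeight (cube d N) y ≤ 2 * d := by
    intro x _
    refine (Finset.sum_le_card_nsmul _ _ 1 fun y _ => bondWeight_le_one _ y).trans ?_
    simpa using (by exact_mod_cast card_neighbors_le x : ((neighbors x).card : ℝ) ≤ 2 * d)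
  refine (Finset.sum_le_card_nsmul _ _ _ h).trans ?_
  simp [cube]

lemma hamiltonian_convex {V : ℝ → ℝ} (hV : IsPotential V) (Γ : Finset (Fin d → ℤ)) {s t : ℝ}
    (hs : 0 ≤ s) (ht : 0 ≤ t) (hst : s + t = 1) (φ ψ : (Fin d → ℤ) → ℝ) :
    hamiltonian V Γ (s • φ + t • ψ) ≤ s * hamiltonian V Γ φ + t * hamiltonian V Γ ψ := by
  simp only [hamiltonian_eq, Finset.mul_sum, ← Finset.sum_add_distrib]
  refine Finset.sum_le_sum fun x _ => Finset.sum_le_sum fun y _ => ?_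
  have h := hV.convexOn.2 (Set.mem_univ (φ x - φ y)) (Set.mem_univ (ψ x - ψ y)) hs ht hst
  have e : (s • φ + t • ψ) x - (s • φ + t • ψ) y = s • (φ x - φ y) + t • (ψ x - ψ y) := by
    simp; ring
  rw [e]
  have := mul_le_mul_of_nonneg_left h (bondWeight_nonneg Γ y)
  simp only [smul_eq_mul] at this ⊢
  linarith

/-- The plane `x ↦ u · x`. -/
def plane (u : E d) (x : Fin d → ℤ) : ℝ := ∑ i, u i * (x i : ℝ)

lemma abs_apply_le_norm (h : E d) (i : Fin d) : |h i| ≤ ‖h‖ := by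
  simpa using PiLp.norm_apply_le h i

lemma plane_sub_sq_le (h : E d) {x y : Fin d → ℤ} (hy : y ∈ neighbors x) :
    (plane h x - plane h y) ^ 2 ≤ ‖h‖ ^ 2 := by
  have key : ∀ i : Fin d, ∀ c : ℤ, plane h (x + Pi.single i c) = plane h x + h i * c := by
    intro i c
    simp [plane, mul_add, Finset.sum_add_distrib, Pi.single_apply]
  simp only [neighbors, Finset.mem_biUnion, Finset.mem_univ, true_and, Finset.mem_insert,
    Finset.mem_singleton] at hy
  obtain ⟨i, rfl | rfl⟩ := hy
  · rw [key, sq_le_sq, abs_norm]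
    simpa using abs_apply_le_norm h i
  · rw [sub_eq_add_neg x, ← Pi.single_neg, key, sq_le_sq, abs_norm]
    simpa using abs_apply_le_norm h i

/-- On every bond the plane `h` has an increment of size at most `‖h‖`, so each bond contributes an
error of at most `c ‖h‖²` times its weight. -/
lemma hamiltonian_midpoint_le {V : ℝ → ℝ} {c : ℝ} (hc : 0 ≤ c)
    (hV : ∀ s r, V (s + r) + V (s - r) ≤ 2 * V s + c * r ^ 2)
    (Γ : Finset (Fin d → ℤ)) (φ : (Fin d → ℤ) → ℝ) (h : E d) :
    hamiltonian V Γ (φ + plane h) + hamiltonian V Γ (φ - plane h) ≤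
      2 * hamiltonian V Γ φ + c * ‖h‖ ^ 2 * totalWeight Γ := by
  simp only [hamiltonian_eq, totalWeight, Finset.mul_sum, ← Finset.sum_add_distrib]
  refine Finset.sum_le_sum fun x _ => Finset.sum_le_sum fun y hy => ?_
  have h1 := hV (φ x - φ y) (plane h x - plane h y)
  have h2 := mul_le_mul_of_nonneg_left (plane_sub_sq_le h hy) hc
  have h3 := mul_le_mul_of_nonneg_left (h1.trans (add_le_add_right h2 _)) (bondWeight_nonneg Γ y)
  have e1 : (φ + plane h) x - (φ + plane h) y = φ x - φ y + (plane h x - plane h y) := by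
    simp; ring
  have e2 : (φ - plane h) x - (φ - plane h) y = φ x - φ y - (plane h x - plane h y) := by
    simp; ring
  rw [e1, e2]
  linarith

/-- Of the quadratic part only one backward bond per site is kept, with weight at least one half.
Differences in one direction already determine the field. -/
lemma hamiltonian_lower_bound {V : ℝ → ℝ} {c : ℝ} (hc : 0 ≤ c) (hV : ∀ η, V 0 + c * η ^ 2 ≤ V η)
    (Γ : Finset (Fin d → ℤ)) (φ : (Fin d → ℤ) → ℝ) (i : Fin d) :
    V 0 * totalWeight Γ + c / 2 * ∑ x ∈ Γ, (φ x - φ (x - Pi.single i 1)) ^ 2 ≤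
      hamiltonian V Γ φ := by
  rw [hamiltonian_eq]
  simp only [totalWeight, Finset.mul_sum, ← Finset.sum_add_distrib]
  refine Finset.sum_le_sum fun x _ => ?_
  have hm : x - Pi.single i 1 ∈ neighbors x := by
    simp only [neighbors, Finset.mem_biUnion, Finset.mem_univ, true_and, Finset.mem_insert,
      Finset.mem_singleton]
    exact ⟨i, Or.inr rfl⟩
  have h1 : c / 2 * (φ x - φ (x - Pi.single i 1)) ^ 2 ≤
      ∑ y ∈ neighbors x, bondWeight Γ y * (c * (φ x - φ y) ^ 2) := by
    refine le_trans ?_ (Finset.single_le_sum (f := fun y => bondWeight Γ y * (c * (φ x - φ y) ^ 2))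
      (fun y _ => mul_nonneg (bondWeight_nonneg Γ y) (by positivity)) hm)
    have := mul_le_mul_of_nonneg_right (half_le_bondWeight Γ (x - Pi.single i 1))
      (by positivity : 0 ≤ c * (φ x - φ (x - Pi.single i 1)) ^ 2)
    linarith
  calc _ ≤ ∑ y ∈ neighbors x, V 0 * bondWeight Γ y +
        ∑ y ∈ neighbors x, bondWeight Γ y * (c * (φ x - φ y) ^ 2) := by linarith
    _ = ∑ y ∈ neighbors x, bondWeight Γ y * (V 0 + c * (φ x - φ y) ^ 2) := by
        rw [← Finset.sum_add_distrib]
        exact Finset.sum_congr rfl fun y _ => by ring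
    _ ≤ _ := Finset.sum_le_sum fun y _ =>
        mul_le_mul_of_nonneg_left (hV _) (bondWeight_nonneg Γ y)

end Hamiltonian

/-! ### Partition functions: integrability, log-concavity, second differences. -/

section PartitionFunction

/-- Joint linearity in tilt and field is what turns convexity of `V` into joint convexity of the
energy. -/
lemma withTiltedBoundary_comb (Γ : Finset (Fin d → ℤ)) (s t : ℝ) (u v : E d) (φ ψ : Γ → ℝ) :
    withTiltedBoundary Γ (s • u + t • v) (s • φ + t • ψ) =
      s • withTiltedBoundary Γ u φ + t • withTiltedBoundary Γ v ψ := by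
  ext x
  by_cases hx : x ∈ Γ
  · simp [withTiltedBoundary, hx]
  · simp [withTiltedBoundary, hx, add_mul, Finset.sum_add_distrib, Finset.mul_sum, mul_assoc]

/-- After this translation, partition functions of different tilts are integrals over the same
fields with zero boundary values. -/
lemma withTiltedBoundary_add_plane (Γ : Finset (Fin d → ℤ)) (u : E d) (φ : Γ → ℝ) :
    withTiltedBoundary Γ u (φ + fun x : Γ => plane u x) = withTiltedBoundary Γ 0 φ + plane u := by
  ext x
  by_cases hx : x ∈ Γ <;> simp [withTiltedBoundary, hx, plane]

/-- The discrete derivative in direction `i` of a height function which vanishes outside `Γ`. -/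
noncomputable def discreteDeriv (Γ : Finset (Fin d → ℤ)) (i : Fin d) : (Γ → ℝ) →ₗ[ℝ] (Γ → ℝ) where
  toFun φ x := withTiltedBoundary Γ 0 φ x -
    withTiltedBoundary Γ 0 φ ((x : Fin d → ℤ) - Pi.single i 1)
  map_add' φ ψ := by
    have := withTiltedBoundary_comb Γ 1 1 0 0 φ ψ
    simp only [one_smul, add_zero] at this
    ext x
    simp only [this, Pi.add_apply]
    ring
  map_smul' c φ := by
    have := withTiltedBoundary_comb Γ c 0 0 0 φ 0
    simp only [smul_zero, zero_smul, add_zero] at this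
    ext x
    simp only [this, Pi.smul_apply, smul_eq_mul, RingHom.id_apply]
    ring

/-- The field is 0 at sites with `i`-th coordinate 0, which lie outside the cube, and vanishing
backward differences carry this value along direction `i`. -/
lemma discreteDeriv_injective (N : ℕ) (i : Fin d) :
    Function.Injective (discreteDeriv (cube d N) i) := by
  rw [← LinearMap.ker_eq_bot, LinearMap.ker_eq_bot']
  intro φ hφ
  have key : ∀ n : ℕ, ∀ x : Fin d → ℤ, x i = n → withTiltedBoundary (cube d N) 0 φ x = 0 := by
    have out : ∀ x, x ∉ cube d N → withTiltedBoundary (cube d N) 0 φ x = 0 := by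
      intro x hx
      simp [withTiltedBoundary, hx]
    intro n
    induction n with
    | zero =>
      intro x hx
      refine out x fun h => ?_
      have := Fintype.mem_piFinset.mp h i
      simp [hx] at this
    | succ n ih =>
      intro x hx
      by_cases h : x ∈ cube d N
      · have h1 := congrFun hφ ⟨x, h⟩
        have h2 := ih (x - Pi.single i 1) (by simp [hx])
        simp only [discreteDeriv, LinearMap.coe_mk, AddHom.coe_mk, h2] at h1
        simpa using h1
      · exact out x h
  ext x
  have h1 := Finset.mem_Icc.mp (Fintype.mem_piFinset.mp x.2 i)
  have := key ((x : Fin d → ℤ) i).toNat x (by omega)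
  simpa [withTiltedBoundary] using this

/-- An injective endomorphism in finite dimension is invertible, so this is a product Gaussian after
an affine change of variables. -/
lemma integrable_gaussian_comp_injective {ι : Type*} [Fintype ι] {c : ℝ} (hc : 0 < c)
    (L : (ι → ℝ) →ₗ[ℝ] (ι → ℝ)) (hL : Function.Injective L) (b : ι → ℝ) :
    Integrable fun φ : ι → ℝ => Real.exp (-(c * ∑ x, (L φ x + b x) ^ 2)) := by
  have h1 : Integrable fun ξ : ι → ℝ => ∏ x, Real.exp (-c * ξ x ^ 2) :=
    Integrable.fintype_prod fun _ => integrable_exp_neg_mul_sq hc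
  have h2 := h1.comp_add_right b
  have hdet : LinearMap.det L ≠ 0 := by
    have := LinearEquiv.isUnit_det' (LinearEquiv.ofInjectiveEndo L hL)
    have e : (LinearEquiv.ofInjectiveEndo L hL : (ι → ℝ) →ₗ[ℝ] (ι → ℝ)) = L := rfl
    exact (e ▸ this).ne_zero
  let e := (LinearEquiv.ofInjectiveEndo L hL).toContinuousLinearEquiv.toHomeomorph.toMeasurableEquiv
  have he : ⇑e = L := rfl
  have h3 : Integrable (fun ξ : ι → ℝ => ∏ x, Real.exp (-c * (ξ + b) x ^ 2))
      (Measure.map e volume) := by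
    rw [he, Measure.map_linearMap_addHaar_eq_smul_addHaar volume hdet]
    exact h2.smul_measure (by simp)
  rw [integrable_map_equiv] at h3
  refine h3.congr (ae_of_all _ fun φ => ?_)
  simp only [Function.comp_apply, he, ← Real.exp_sum, Pi.add_apply, neg_mul, Finset.sum_neg_distrib,
    Finset.mul_sum]

lemma continuous_hamiltonian {V : ℝ → ℝ} (hV : Continuous V) (Γ : Finset (Fin d → ℤ)) (u : E d) :
    Continuous fun φ : Γ → ℝ => hamiltonian V Γ (withTiltedBoundary Γ u φ) := by
  have h : ∀ x, Continuous fun φ : Γ → ℝ => withTiltedBoundary Γ u φ x := by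
    intro x
    by_cases hx : x ∈ Γ
    · simp only [withTiltedBoundary, hx, dite_true]; fun_prop
    · simp only [withTiltedBoundary, hx, dite_false]; fun_prop
  simp only [hamiltonian_eq]
  fun_prop

variable {V : ℝ → ℝ}

/-- The Gaussian domination uses differences in one direction, which exists since `1 ≤ d`. Without
integrability the partition function would be 0 by convention. -/
lemma integrable_exp_neg_hamiltonian (hV : IsPotential V) (hd : 1 ≤ d) (N : ℕ) (u : E d) :
    Integrable fun φ : cube d N → ℝ =>
      Real.exp (-hamiltonian V (cube d N) (withTiltedBoundary (cube d N) u φ)) := by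
  obtain ⟨c, hc, hcV⟩ := hV.exists_quadratic_le
  let i : Fin d := ⟨0, hd⟩
  set Γ := cube d N
  let b : Γ → ℝ := fun x => withTiltedBoundary Γ u 0 x -
    withTiltedBoundary Γ u 0 ((x : Fin d → ℤ) - Pi.single i 1)
  have h1 := (integrable_gaussian_comp_injective (half_pos hc) (discreteDeriv Γ i)
    (discreteDeriv_injective N i) b).const_mul (Real.exp (-(V 0 * totalWeight Γ)))
  refine h1.mono' (Real.continuous_exp.comp (continuous_hamiltonian
    hV.contDiff.continuous Γ u).neg).aestronglyMeasurable (ae_of_all _ fun φ => ?_)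
  rw [Real.norm_eq_abs, Real.abs_exp, ← Real.exp_add, Real.exp_le_exp]
  have h2 := hamiltonian_lower_bound hc.le hcV Γ (withTiltedBoundary Γ u φ) i
  have h3 : withTiltedBoundary Γ u φ = withTiltedBoundary Γ 0 φ + withTiltedBoundary Γ u 0 := by
    have := withTiltedBoundary_comb Γ 1 1 0 u φ 0
    simpa using this
  have h4 : ∑ x ∈ Γ, (withTiltedBoundary Γ u φ x -
      withTiltedBoundary Γ u φ (x - Pi.single i 1)) ^ 2 =
      ∑ x : Γ, (discreteDeriv Γ i φ x + b x) ^ 2 := by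
    rw [← Finset.sum_coe_sort Γ]
    refine Finset.sum_congr rfl fun x _ => ?_
    simp only [h3, discreteDeriv, b, LinearMap.coe_mk, AddHom.coe_mk, Pi.add_apply]
    ring
  rw [h4] at h2
  linarith

lemma partitionFunction_pos (hV : IsPotential V) (hd : 1 ≤ d) (N : ℕ) (u : E d) :
    0 < partitionFunction V (cube d N) u :=
  integral_exp_pos (integrable_exp_neg_hamiltonian hV hd N u)

lemma ofReal_partitionFunction (hV : IsPotential V) (hd : 1 ≤ d) (N : ℕ) (u : E d) :
    ENNReal.ofReal (partitionFunction V (cube d N) u) = ∫⁻ φ : cube d N → ℝ, ENNReal.ofReal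
      (Real.exp (-hamiltonian V (cube d N) (withTiltedBoundary (cube d N) u φ))) :=
  ofReal_integral_eq_lintegral_ofReal (integrable_exp_neg_hamiltonian hV hd N u)
    (ae_of_all _ fun _ => (Real.exp_pos _).le)

lemma ofReal_exp_rpow (a s : ℝ) :
    ENNReal.ofReal (Real.exp a) ^ s = ENNReal.ofReal (Real.exp (s * a)) := by
  rw [ENNReal.ofReal_rpow_of_pos (Real.exp_pos a), ← Real.exp_mul, mul_comm]

/-- The partition function is log-concave as a function of the tilt. -/
lemma log_partitionFunction_concave (hV : IsPotential V) (hd : 1 ≤ d) (N : ℕ) {s t : ℝ}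
    (hs : 0 < s) (ht : 0 < t) (hst : s + t = 1) (u v : E d) :
    s * Real.log (partitionFunction V (cube d N) u) +
      t * Real.log (partitionFunction V (cube d N) v) ≤
      Real.log (partitionFunction V (cube d N) (s • u + t • v)) := by
  have meas : ∀ u : E d, Measurable fun φ : cube d N → ℝ => ENNReal.ofReal
      (Real.exp (-hamiltonian V (cube d N) (withTiltedBoundary (cube d N) u φ))) := fun u =>
    (Real.continuous_exp.comp (continuous_hamiltonian
      hV.contDiff.continuous _ u).neg).measurable.ennreal_ofReal
  -- The pointwise hypothesis is joint convexity of the energy in tilt and field.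
  have h := prekopaLeindler hs ht hst (meas u) (meas v) (meas (s • u + t • v)) fun φ ψ => by
    rw [ofReal_exp_rpow, ofReal_exp_rpow, ← ENNReal.ofReal_mul (Real.exp_pos _).le, ← Real.exp_add,
      withTiltedBoundary_comb]
    refine ENNReal.ofReal_le_ofReal (Real.exp_le_exp.mpr ?_)
    linarith [hamiltonian_convex hV (cube d N) hs.le ht.le hst
      (withTiltedBoundary (cube d N) u φ) (withTiltedBoundary (cube d N) v ψ)]
  have pu := partitionFunction_pos hV hd N u
  have pv := partitionFunction_pos hV hd N v
  rw [← ofReal_partitionFunction hV hd, ← ofReal_partitionFunction hV hd,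
    ← ofReal_partitionFunction hV hd, ENNReal.ofReal_rpow_of_pos pu, ENNReal.ofReal_rpow_of_pos pv,
    ← ENNReal.ofReal_mul (by positivity),
    ENNReal.ofReal_le_ofReal_iff (partitionFunction_pos hV hd N _).le] at h
  have := Real.log_le_log (by positivity) h
  rwa [Real.log_mul (by positivity) (by positivity), Real.log_rpow pu, Real.log_rpow pv] at this

/-- On common fields, the midpoint bound for the energy estimates the weight at `u` by the geometric
mean of the weights at `u ± h`, up to a factor `exp (K / 2)`. The Cauchy–Schwarz inequality then
integrates this. -/
lemma log_partitionFunction_midpoint (hV : IsPotential V) (hd : 1 ≤ d) {c : ℝ} (hc : 0 ≤ c)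
    (hcV : ∀ s r, V (s + r) + V (s - r) ≤ 2 * V s + c * r ^ 2) (N : ℕ) (u h : E d) :
    2 * Real.log (partitionFunction V (cube d N) u) ≤ c * ‖h‖ ^ 2 * totalWeight (cube d N) +
      Real.log (partitionFunction V (cube d N) (u + h)) +
      Real.log (partitionFunction V (cube d N) (u - h)) := by
  set Γ := cube d N
  set K := c * ‖h‖ ^ 2 * totalWeight Γ
  let g : E d → (Γ → ℝ) → ENNReal := fun v φ =>
    ENNReal.ofReal (Real.exp (-hamiltonian V Γ (withTiltedBoundary Γ 0 φ + plane v)))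
  have eq : ∀ v : E d, ∫⁻ φ, g v φ = ENNReal.ofReal (partitionFunction V Γ v) := by
    intro v
    rw [ofReal_partitionFunction hV hd, ← lintegral_add_right_eq_self (fun φ : Γ → ℝ =>
      ENNReal.ofReal (Real.exp (-hamiltonian V Γ (withTiltedBoundary Γ v φ))))
      fun x : Γ => plane v x]
    simp only [g, withTiltedBoundary_add_plane]
  have meas : ∀ v : E d, Measurable (g v) := by
    intro v
    simp only [g, ← withTiltedBoundary_add_plane]
    exact (Real.continuous_exp.comp ((continuous_hamiltonian
      hV.contDiff.continuous Γ v).comp (by fun_prop)).neg).measurable.ennreal_ofReal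
  have pt : ∀ φ, g u φ ≤ ENNReal.ofReal (Real.exp (K / 2)) *
      (g (u + h) φ ^ (1 / 2 : ℝ) * g (u - h) φ ^ (1 / 2 : ℝ)) := by
    intro φ
    simp only [g]
    rw [ofReal_exp_rpow, ofReal_exp_rpow, ← ENNReal.ofReal_mul (Real.exp_pos _).le, ← Real.exp_add,
      ← ENNReal.ofReal_mul (Real.exp_pos _).le, ← Real.exp_add]
    refine ENNReal.ofReal_le_ofReal (Real.exp_le_exp.mpr ?_)
    have := hamiltonian_midpoint_le hc hcV Γ (withTiltedBoundary Γ 0 φ + plane u) h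
    have e1 : plane (u + h) = plane u + plane h := by
      ext x; simp [plane, add_mul, Finset.sum_add_distrib]
    have e2 : plane (u - h) = plane u - plane h := by
      ext x; simp [plane, sub_mul, Finset.sum_sub_distrib]
    simp only [e1, e2, K, add_sub_assoc, add_assoc] at this ⊢
    linarith
  have hold := (lintegral_mono (μ := volume) pt).trans_eq (lintegral_const_mul' _ _ (by simp))
  have h2 := hold.trans (mul_le_mul_right (ENNReal.lintegral_mul_norm_pow_le
    (meas (u + h)).aemeasurable (meas (u - h)).aemeasurable (by norm_num : (0 : ℝ) ≤ 1 / 2)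
    (by norm_num : (0 : ℝ) ≤ 1 / 2) (by norm_num)) _)
  have p := partitionFunction_pos hV hd N u
  have p1 := partitionFunction_pos hV hd N (u + h)
  have p2 := partitionFunction_pos hV hd N (u - h)
  rw [eq, eq, eq, ENNReal.ofReal_rpow_of_pos p1, ENNReal.ofReal_rpow_of_pos p2,
    ← ENNReal.ofReal_mul (by positivity), ← ENNReal.ofReal_mul (by positivity),
    ENNReal.ofReal_le_ofReal_iff (by positivity)] at h2
  have := Real.log_le_log p h2
  rw [Real.log_mul (by positivity) (by positivity), Real.log_exp,
    Real.log_mul (by positivity) (by positivity), Real.log_rpow p1, Real.log_rpow p2] at this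
  linarith

end PartitionFunction

/-! ### Convexity and bounded second differences of the surface tension. -/

section SurfaceTension

variable {V : ℝ → ℝ} {σ : E d → ℝ}

lemma IsSurfaceTension.convexOn (hσ : IsSurfaceTension V σ) (hV : IsPotential V) (hd : 1 ≤ d) :
    ConvexOn ℝ Set.univ σ := by
  refine convexOn_iff_forall_pos.mpr ⟨convex_univ, fun u _ v _ s t hs ht hst => ?_⟩
  refine le_of_tendsto_of_tendsto (hσ _) (((hσ u).const_smul s).add ((hσ v).const_smul t))
    (Eventually.of_forall fun N => ?_)
  have p := fun w => (partitionFunction_pos hV hd N w).ne'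
  have h := log_partitionFunction_concave hV hd N hs ht hst u v
  simp only [smul_eq_mul, Real.log_div (p _) (p _)]
  have h3 : (0 : ℝ) ≤ ((N : ℝ) ^ d)⁻¹ := by positivity
  have h4 := mul_le_mul_of_nonneg_left h h3
  have h5 : t = 1 - s := by linarith
  subst h5
  nlinarith

lemma IsSurfaceTension.exists_midpoint_le (hσ : IsSurfaceTension V σ) (hV : IsPotential V)
    (hd : 1 ≤ d) :
    ∃ L, 0 ≤ L ∧ ∀ u h, σ (u + h) + σ (u - h) ≤ 2 * σ u + L * ‖h‖ ^ 2 := by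
  obtain ⟨c, hc, hcV⟩ := hV.exists_midpoint_le
  -- The total bond weight of the cube is at most `2d N^d`, so the error stays bounded after
  -- division by the volume.
  refine ⟨c * (2 * d), by positivity, fun u h => ?_⟩
  refine le_of_tendsto_of_tendsto ((hσ (u + h)).add (hσ (u - h)))
    (((hσ u).const_mul 2).add_const _) (Eventually.of_forall fun N => ?_)
  have p := fun w => (partitionFunction_pos hV hd N w).ne'
  have h1 := log_partitionFunction_midpoint hV hd hc.le hcV N u h
  simp only [Real.log_div (p _) (p _)]
  have h3 : (0 : ℝ) ≤ ((N : ℝ) ^ d)⁻¹ := by positivity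
  have h4 := mul_le_mul_of_nonneg_left h1 h3
  have h5 : ((N : ℝ) ^ d)⁻¹ * totalWeight (cube d N) ≤ 2 * d := by
    refine (mul_le_mul_of_nonneg_left (totalWeight_cube_le d N) h3).trans ?_
    rw [← mul_assoc]
    exact mul_le_of_le_one_left (by positivity) inv_mul_le_one
  have h6 := mul_le_mul_of_nonneg_left h5 (by positivity : 0 ≤ c * ‖h‖ ^ 2)
  linarith

end SurfaceTension

/-! ### The gradient of a convex function with bounded second differences. -/

section Convex

variable {σ : E d → ℝ}

/-- A finite convex function on a finite-dimensional space has a subgradient at every point. -/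
lemma exists_subgradient (hc : ConvexOn ℝ Set.univ σ) (u : E d) :
    ∃ p : E d, ∀ h, σ u + inner ℝ p h ≤ σ (u + h) := by
  have hcont : Continuous σ := continuousOn_univ.mp (hc.continuousOn isOpen_univ)
  have ho : IsOpen {q : E d × ℝ | σ q.1 < q.2} :=
    isOpen_lt (hcont.comp continuous_fst) continuous_snd
  have hconv : Convex ℝ {q : E d × ℝ | σ q.1 < q.2} := by
    simpa using hc.convex_strict_epigraph
  obtain ⟨f, hf⟩ := geometric_hahn_banach_open_point hconv ho (x := (u, σ u)) (by simp)
  have hsplit : ∀ (x : E d) (r : ℝ), f (x, r) = f (x, 0) + r * f (0, 1) := by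
    intro x r
    have : ((x, r) : E d × ℝ) = (x, 0) + r • (0, 1) := by simp
    rw [this, map_add, map_smul, smul_eq_mul]
  -- The separating hyperplane is not vertical, so it can be rescaled to the graph of an affine
  -- function.
  have hneg : f (0, 1) < 0 := by
    have h1 := hf (u, σ u + 1) (by simp)
    rw [hsplit, hsplit u (σ u)] at h1
    linarith
  set c := f (0, 1)
  let g : StrongDual ℝ (E d) := (-c)⁻¹ • f.comp (ContinuousLinearMap.inl ℝ (E d) ℝ)
  refine ⟨(InnerProductSpace.toDual ℝ (E d)).symm g, fun h => ?_⟩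
  rw [InnerProductSpace.toDual_symm_apply]
  refine le_of_forall_pos_le_add fun ε hε => ?_
  have h1 := hf (u + h, σ (u + h) + ε) (by simpa using hε)
  rw [hsplit, hsplit u (σ u)] at h1
  have h2 : f (u + h, 0) = f (u, 0) + f (h, 0) := by
    rw [← map_add]; simp
  have h3 : (-c) * g h = f (h, 0) := by
    simp only [g, smul_apply, smul_eq_mul, ContinuousLinearMap.comp_apply,
      ContinuousLinearMap.inl_apply]
    rw [← mul_assoc, mul_inv_cancel₀ (by linarith), one_mul]
  have h4 : (-c) * (σ u + g h) ≤ (-c) * (σ (u + h) + ε) := by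
    rw [mul_add, h3]
    linarith
  exact le_of_mul_le_mul_left h4 (by linarith)

variable {L : ℝ}

/-- The subgradient inequality at `-h` bounds `σ (u - h)` from below. Thus `σ` is squeezed to within
`L ‖h‖²` of an affine function, which yields differentiability. -/
lemma upper_bound_of_subgradient (hL : ∀ u h, σ (u + h) + σ (u - h) ≤ 2 * σ u + L * ‖h‖ ^ 2)
    {u p : E d} (hp : ∀ h, σ u + inner ℝ p h ≤ σ (u + h)) (h : E d) :
    σ (u + h) ≤ σ u + inner ℝ p h + L * ‖h‖ ^ 2 := by
  have h1 := hp (-h)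
  have h2 := hL u h
  rw [inner_neg_right, ← sub_eq_add_neg u] at h1
  linarith

lemma hasGradientAt_of_subgradient (hL : ∀ u h, σ (u + h) + σ (u - h) ≤ 2 * σ u + L * ‖h‖ ^ 2)
    {u p : E d} (hp : ∀ h, σ u + inner ℝ p h ≤ σ (u + h)) : HasGradientAt σ p u := by
  rw [hasGradientAt_iff_isLittleO_nhds_zero]
  have : (fun h : E d => σ (u + h) - σ u - inner ℝ p h) =O[𝓝 0] fun h : E d => ‖h‖ ^ 2 := by
    refine Asymptotics.IsBigO.of_bound L (Eventually.of_forall fun h => ?_)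
    have h1 := hp h
    have h2 := upper_bound_of_subgradient hL hp h
    rw [Real.norm_of_nonneg (by linarith), Real.norm_of_nonneg (by positivity)]
    linarith
  exact this.trans_isLittleO (by simpa using Asymptotics.isLittleO_norm_pow_id one_lt_two)

lemma gradient_subgradient (hc : ConvexOn ℝ Set.univ σ)
    (hL : ∀ u h, σ (u + h) + σ (u - h) ≤ 2 * σ u + L * ‖h‖ ^ 2) (u h : E d) :
    σ u + inner ℝ (gradient σ u) h ≤ σ (u + h) := by
  obtain ⟨p, hp⟩ := exists_subgradient hc u
  rw [(hasGradientAt_of_subgradient hL hp).gradient]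
  exact hp h

/-- Sum of the subgradient inequalities at `a` and at `b`; this monotonicity is the source of the
contraction. -/
lemma inner_gradient_sub_nonneg (hc : ConvexOn ℝ Set.univ σ)
    (hL : ∀ u h, σ (u + h) + σ (u - h) ≤ 2 * σ u + L * ‖h‖ ^ 2) (a b : E d) :
    0 ≤ inner ℝ (gradient σ a - gradient σ b) (a - b) := by
  have h1 := gradient_subgradient hc hL a (b - a)
  have h2 := gradient_subgradient hc hL b (a - b)
  rw [add_sub_cancel] at h1 h2
  rw [inner_sub_left]
  rw [← neg_sub, inner_neg_right] at h1
  linarith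

lemma norm_gradient_le (hc : ConvexOn ℝ Set.univ σ) (hL0 : 0 ≤ L)
    (hL : ∀ u h, σ (u + h) + σ (u - h) ≤ 2 * σ u + L * ‖h‖ ^ 2) (u : E d) :
    ‖gradient σ u‖ ≤ (‖gradient σ 0‖ + 4 * L) + 4 * L * ‖u‖ := by
  set g := gradient σ u
  -- A step of length `r` along the gradient gains at least `r ‖g‖`, while the quadratic bound
  -- around 0 allows a gain of order `r + r²`. Division by `r` leaves linear growth; the 1 keeps `r`
  -- positive.
  set r := ‖u‖ + 1
  have hr : 0 < r := by positivity
  rcases eq_or_ne g 0 with h0 | h0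
  · rw [h0, norm_zero]; positivity
  have hg : 0 < ‖g‖ := norm_pos_iff.mpr h0
  let h : E d := (r / ‖g‖) • g
  have hh : ‖h‖ = r := by
    simp only [h, norm_smul, Real.norm_eq_abs, abs_of_pos (div_pos hr hg)]
    field_simp
  have h1 := gradient_subgradient hc hL u h
  have h2 := upper_bound_of_subgradient hL (gradient_subgradient hc hL 0) (u + h)
  have h3 := gradient_subgradient hc hL 0 u
  rw [zero_add] at h2 h3
  have h4 : inner ℝ g h = r * ‖g‖ := by
    simp only [h, inner_smul_right, real_inner_self_eq_norm_sq]
    field_simp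
  have h5 : ‖u + h‖ ≤ 2 * r := (norm_add_le _ _).trans (by rw [hh]; linarith)
  have h6 : inner ℝ (gradient σ 0) h ≤ ‖gradient σ 0‖ * r := hh ▸ real_inner_le_norm _ h
  have h7 : L * ‖u + h‖ ^ 2 ≤ L * (2 * r) ^ 2 := by gcongr
  rw [inner_add_right] at h2
  have h8 : r * ‖g‖ ≤ r * (‖gradient σ 0‖ + 4 * L * r) := by nlinarith
  have h9 := le_of_mul_le_mul_left h8 hr
  simp only [r] at h9
  linarith

lemma measurable_gradient (σ : E d → ℝ) : Measurable (gradient σ) :=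
  (InnerProductSpace.toDual ℝ (E d)).symm.continuous.measurable.comp (measurable_fderiv ℝ σ)

end Convex

/-! ### Monotonicity from left difference quotients. -/

section Dissipation

lemma tendsto_left_slope {P : ℝ → ℝ} {P' x : ℝ} (h : HasDerivAt P P' x) {δ : ℕ → ℝ}
    (hδ0 : ∀ n, 0 < δ n) (hδ : Tendsto δ atTop (𝓝 0)) :
    Tendsto (fun n => (P x - P (x - δ n)) / δ n) atTop (𝓝 P') := by
  have h1 := hasDerivAt_iff_tendsto_slope_zero.mp h
  have h2 : Tendsto (fun n => -δ n) atTop (𝓝[≠] 0) :=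
    tendsto_nhdsWithin_iff.mpr ⟨by simpa using hδ.neg, Eventually.of_forall fun n =>
      by simpa using (hδ0 n).ne'⟩
  refine (h1.comp h2).congr fun n => ?_
  have := (hδ0 n).ne'
  simp only [Function.comp_apply, smul_eq_mul, sub_eq_add_neg x]
  field_simp
  ring

/-- The integral telescopes to the average of `K` over `[T - δ, T]` minus its average over `[-δ,
0]`. -/
lemma tendsto_integral_left_slope {K : ℝ → ℝ} (hK : Continuous K) (T : ℝ) {δ : ℕ → ℝ}
    (hδ0 : ∀ n, 0 < δ n) (hδ : Tendsto δ atTop (𝓝 0)) :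
    Tendsto (fun n => ∫ t in 0..T, (K t - K (t - δ n)) / δ n) atTop (𝓝 (K T - K 0)) := by
  have hP : ∀ x, HasDerivAt (fun x => ∫ t in 0..x, K t) (K x) x := fun x =>
    intervalIntegral.integral_hasDerivAt_right (hK.intervalIntegrable _ _)
      (hK.stronglyMeasurableAtFilter _ _) hK.continuousAt
  refine ((tendsto_left_slope (hP T) hδ0 hδ).sub (tendsto_left_slope (hP 0) hδ0 hδ)).congr
    fun n => ?_
  have i : ∀ a b, IntervalIntegrable K volume a b := fun a b => hK.intervalIntegrable a b
  have e : ∫ t in 0..T, K (t - δ n) = (∫ t in 0..T - δ n, K t) - ∫ t in 0..0 - δ n, K t := by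
    rw [intervalIntegral.integral_comp_sub_right K, intervalIntegral.integral_interval_sub_left
      (i _ _) (i _ _)]
  rw [intervalIntegral.integral_div, intervalIntegral.integral_sub (i _ _)
    (Continuous.intervalIntegrable (by fun_prop) _ _), e, intervalIntegral.integral_same]
  ring

/-- A continuous function on `[0, T]` whose left difference quotients are dominated by averages of
integrable functions decreases if its upper left derivative is nonpositive almost everywhere. -/
lemma le_of_left_slope_le {T : ℝ} (hT : 0 ≤ T) {φ q p : ℝ → ℝ}
    (hφ : ContinuousOn φ (Set.Icc 0 T)) (hq : Integrable q)
    (hp : IntegrableOn p (Set.Icc 0 T)) (hq0 : ∀ t, 0 ≤ q t) (hp0 : ∀ t, 0 ≤ p t)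
    (h1 : ∀ᵐ t ∂timeVol T, ∀ s ∈ Set.Icc 0 t, φ t - φ s ≤ (∫ r in s..t, q r) + (t - s) * p t)
    (h2 : ∀ᵐ t ∂timeVol T, ∀ ε > 0, ∀ᶠ s in 𝓝[<] t, φ t - φ s ≤ ε * (t - s)) :
    φ T ≤ φ 0 := by
  set δ : ℕ → ℝ := fun n => 1 / ((n : ℝ) + 1)
  have hδ0 : ∀ n, 0 < δ n := fun n => by positivity
  have hδ : Tendsto δ atTop (𝓝 0) := tendsto_one_div_add_atTop_nhds_zero_nat
  -- Constant extension gives a meaning to difference quotients reaching to the left of 0.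
  set Φ : ℝ → ℝ := fun t => φ (Set.projIcc 0 T hT t)
  have hΦ : Continuous Φ := (continuousOn_iff_continuous_domRestrict.mp hφ).comp continuous_projIcc
  have hΦeq : ∀ t ∈ Set.Icc 0 T, Φ t = φ t := fun t ht => by
    simp only [Φ, Set.projIcc_of_mem hT ht]
  have hΦneg : ∀ t ≤ 0, Φ t = φ 0 := fun t ht => by
    simp only [Φ, Set.projIcc_of_le_left hT ht]
  set Q : ℝ → ℝ := fun t => ∫ r in 0..t, q r
  have hqi : ∀ a b, IntervalIntegrable q volume a b := fun a b => hq.intervalIntegrable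
  have hQ : Continuous Q := intervalIntegral.continuous_primitive hqi 0
  have hQsub : ∀ s t, Q t - Q s = ∫ r in s..t, q r := fun s t =>
    intervalIntegral.integral_interval_sub_left (hqi _ _) (hqi _ _)
  have hQmono : ∀ s t, s ≤ t → Q s ≤ Q t := fun s t hst => by
    have := intervalIntegral.integral_nonneg (μ := volume) hst fun r _ => hq0 r
    linarith [hQsub s t]
  -- The gap in the domination of the quotients is nonnegative, so Fatou's lemma applies to it: its
  -- lower limit is at least `q + p`, while its integrals tend to `∫ q + ∫ p - (φ T - φ 0)`.
  set Y : ℕ → ℝ → ℝ := fun n t =>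
    (Q t - Q (t - δ n)) / δ n + p t - (Φ t - Φ (t - δ n)) / δ n
  have hQc : ∀ n, Continuous fun t => (Q t - Q (t - δ n)) / δ n := fun n => by fun_prop
  have hΦc : ∀ n, Continuous fun t => (Φ t - Φ (t - δ n)) / δ n := fun n => by fun_prop
  have ci : ∀ {K : ℝ → ℝ}, Continuous K → Integrable K (timeVol T) := fun hK =>
    hK.continuousOn.integrableOn_compact isCompact_Icc
  have hYi : ∀ n, Integrable (Y n) (timeVol T) := fun n => ((ci (hQc n)).add hp).sub (ci (hΦc n))
  have hY0 : ∀ᵐ t ∂timeVol T, ∀ n, 0 ≤ Y n t := by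
    filter_upwards [h1, ae_restrict_mem measurableSet_Icc] with t ht htT n
    have key : Φ t - Φ (t - δ n) ≤ Q t - Q (t - δ n) + δ n * p t := by
      rcases le_or_gt 0 (t - δ n) with h | h
      · have := ht (t - δ n) ⟨h, by linarith [hδ0 n]⟩
        rw [hΦeq t htT, hΦeq (t - δ n) ⟨h, by linarith [hδ0 n, htT.2]⟩, hQsub]
        linarith
      · have := ht 0 ⟨le_rfl, htT.1⟩
        rw [hΦeq t htT, hΦneg _ h.le]
        rw [← hQsub] at this
        have h3 := hQmono (t - δ n) 0 h.le
        have h4 := mul_le_mul_of_nonneg_right (by linarith : t - 0 ≤ δ n) (hp0 t)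
        linarith
    have h5 := hδ0 n
    have h6 : Y n t = (Q t - Q (t - δ n) + δ n * p t - (Φ t - Φ (t - δ n))) / δ n := by
      simp only [Y]
      field_simp
    rw [h6]
    exact div_nonneg (by linarith) h5.le
  have hlim : Tendsto (fun n => ∫ t, Y n t ∂timeVol T) atTop
      (𝓝 (Q T - Q 0 + ∫ t, p t ∂timeVol T - (Φ T - Φ 0))) := by
    have conv : ∀ K : ℝ → ℝ, ∫ t, K t ∂timeVol T = ∫ t in 0..T, K t := fun K => by
      rw [intervalIntegral.integral_of_le hT, integral_Icc_eq_integral_Ioc]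
    refine (((tendsto_integral_left_slope hQ T hδ0 hδ).add_const (∫ t, p t ∂timeVol T)).sub
      (tendsto_integral_left_slope hΦ T hδ0 hδ)).congr fun n => ?_
    have e1 := integral_sub ((ci (hQc n)).add hp) (ci (hΦc n))
    have e2 := integral_add (ci (hQc n)) hp
    rw [← conv, ← conv, ← e2]
    exact e1.symm
  have hliminf : ∀ᵐ t ∂timeVol T, ENNReal.ofReal (q t + p t) ≤
      liminf (fun n => ENNReal.ofReal (Y n t)) atTop := by
    filter_upwards [h2, ae_restrict_mem measurableSet_Icc,
      ae_restrict_of_ae (LocallyIntegrable.ae_hasDerivAt_integral hq.locallyIntegrable),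
      ae_restrict_of_ae (compl_mem_ae_iff.mpr (by simp : volume ({0} : Set ℝ) = 0))]
      with t ht htT hder ht0
    have ht0' : 0 < t := lt_of_le_of_ne htT.1 (Ne.symm ht0)
    have hε : Tendsto (fun ε => ENNReal.ofReal (q t + p t - 2 * ε)) (𝓝[>] 0)
        (𝓝 (ENNReal.ofReal (q t + p t))) := by
      refine ENNReal.tendsto_ofReal (Tendsto.mono_left ?_ nhdsWithin_le_nhds)
      have : Continuous fun ε : ℝ => q t + p t - 2 * ε := by fun_prop
      simpa using this.tendsto 0
    refine le_of_tendsto hε (eventually_nhdsWithin_of_forall fun ε (hε : 0 < ε) => ?_)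
    refine le_liminf_of_le (by isBoundedDefault) ?_
    have hs : Tendsto (fun n => t - δ n) atTop (𝓝[<] t) :=
      tendsto_nhdsWithin_iff.mpr ⟨by simpa using tendsto_const_nhds.sub hδ,
        Eventually.of_forall fun n => by simpa using hδ0 n⟩
    filter_upwards [hs.eventually (ht ε hε), (tendsto_left_slope (hder 0) hδ0 hδ).eventually
      (lt_mem_nhds (sub_lt_self (q t) hε)), hδ.eventually (gt_mem_nhds ht0')] with n a b c
    refine ENNReal.ofReal_le_ofReal ?_
    have hn := hδ0 n
    rw [← hΦeq t htT, ← hΦeq (t - δ n) ⟨by linarith, by linarith [htT.2]⟩, sub_sub_cancel,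
      ← div_le_iff₀ hn] at a
    simp only [Y, Q]
    linarith
  have hfatou := lintegral_liminf_le' (μ := timeVol T) (u := atTop) (f := fun n t => ENNReal.ofReal (Y n t))
    fun n => (hYi n).aestronglyMeasurable.aemeasurable.ennreal_ofReal
  have h3 := (lintegral_mono_ae hliminf).trans hfatou
  have h4 : ∀ n, ∫⁻ t, ENNReal.ofReal (Y n t) ∂timeVol T = ENNReal.ofReal (∫ t, Y n t ∂timeVol T) :=
    fun n => (ofReal_integral_eq_lintegral_ofReal (hYi n) (hY0.mono fun t ht => ht n)).symm
  have hqr : Integrable q (timeVol T) := hq.restrict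
  simp only [h4] at h3
  have h5 : ∫⁻ t, ENNReal.ofReal (q t + p t) ∂timeVol T =
      ENNReal.ofReal (∫ t, q t ∂timeVol T + ∫ t, p t ∂timeVol T) := by
    rw [← integral_add hqr hp]
    exact (ofReal_integral_eq_lintegral_ofReal (hqr.add hp)
      (ae_of_all _ fun t => add_nonneg (hq0 t) (hp0 t))).symm
  rw [(ENNReal.tendsto_ofReal hlim).liminf_eq, h5, ENNReal.ofReal_le_ofReal_iff
    (ge_of_tendsto' hlim fun n => integral_nonneg_of_ae (hY0.mono fun t ht => ht n)),
    integral_Icc_eq_integral_Ioc (f := q), ← intervalIntegral.integral_of_le hT, ← hQsub,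
    hΦeq T ⟨hT, le_rfl⟩, hΦneg 0 le_rfl] at h3
  linarith

end Dissipation

/-! ### Averages along segments. -/

section Averaging

/-- The Cauchy–Schwarz inequality with a weight. -/
lemma sq_lintegral_mul_le {α : Type*} [MeasurableSpace α] {μ : Measure α} {w f : α → ENNReal}
    (hw : AEMeasurable w μ) (hf : AEMeasurable f μ) :
    (∫⁻ x, w x * f x ∂μ) ^ 2 ≤ (∫⁻ x, w x ∂μ) * ∫⁻ x, w x * f x ^ 2 ∂μ := by
  have h := ENNReal.lintegral_mul_norm_pow_le hw (hw.mul (hf.pow_const 2))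
    (by norm_num : (0 : ℝ) ≤ 1 / 2) (by norm_num : (0 : ℝ) ≤ 1 / 2) (by norm_num)
  have e : ∀ x, w x ^ (1 / 2 : ℝ) * (w x * f x ^ 2) ^ (1 / 2 : ℝ) = w x * f x := by
    intro x
    rw [← ENNReal.mul_rpow_of_nonneg _ _ (by norm_num), ← mul_assoc, ← sq, ← mul_pow,
      ← ENNReal.rpow_natCast, ← ENNReal.rpow_mul]
    norm_num
  simp only [Pi.mul_apply, e] at h
  calc _ ≤ ((∫⁻ x, w x ∂μ) ^ (1 / 2 : ℝ) * (∫⁻ x, w x * f x ^ 2 ∂μ) ^ (1 / 2 : ℝ)) ^ 2 := by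
        gcongr
    _ = _ := by
        rw [← ENNReal.mul_rpow_of_nonneg _ _ (by norm_num), ← ENNReal.rpow_natCast,
          ← ENNReal.rpow_mul]
        norm_num

lemma lintegral_add_smul_le (f : E d → ENNReal) (hf : Measurable f) (c : E d) {θ : ℝ}
    (hθ : 1 / 2 ≤ θ) : ∫⁻ y, f (c + θ • y) ≤ 2 ^ d * ∫⁻ y, f y := by
  have hθ0 : 0 < θ := by linarith
  have h1 : ∫⁻ y, f (c + θ • y) = ∫⁻ y, f (c + y) ∂(Measure.map (θ • ·) volume) := by
    rw [lintegral_map (by fun_prop) (by fun_prop)]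
  rw [h1, Measure.map_addHaar_smul _ hθ0.ne', lintegral_smul_measure, lintegral_add_left_eq_self]
  refine mul_le_mul_left ?_ _
  have : (θ ^ d)⁻¹ ≤ 2 ^ d := by
    rw [← inv_pow]
    gcongr
    rw [inv_le_comm₀ hθ0 two_pos]
    linarith
  simp only [finrank_euclideanSpace, Fintype.card_fin, abs_inv, abs_pow, abs_of_pos hθ0]
  refine (ENNReal.ofReal_le_ofReal this).trans_eq ?_
  rw [ENNReal.ofReal_pow (by norm_num)]
  simp

/-- The average of `f` along all segments between two sets is controlled by `∫ f`. -/
lemma lintegral_segment_le (f : E d → ENNReal) (hf : Measurable f) (A B : Set (E d)) :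
    ∫⁻ x in A, ∫⁻ y in B, ∫⁻ θ in Set.Icc (0 : ℝ) 1, f (x + θ • (y - x)) ≤
      2 ^ d * (volume A + volume B) * ∫⁻ z, f z := by
  have m3 : Measurable fun q : (ℝ × E d) × E d => f (q.1.2 + q.1.1 • (q.2 - q.1.2)) := by fun_prop
  have swap1 : ∀ x, ∫⁻ y in B, ∫⁻ θ in Set.Icc (0 : ℝ) 1, f (x + θ • (y - x)) =
      ∫⁻ θ in Set.Icc (0 : ℝ) 1, ∫⁻ y in B, f (x + θ • (y - x)) := fun x =>
    lintegral_lintegral_swap (Measurable.aemeasurable (by fun_prop))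
  simp only [swap1]
  rw [lintegral_lintegral_swap]
  swap
  · refine Measurable.aemeasurable ?_
    have := m3.lintegral_prod_right' (ν := volume.restrict B)
    exact this.comp measurable_swap
  have bound : ∀ θ ∈ Set.Icc (0 : ℝ) 1, ∫⁻ x in A, ∫⁻ y in B, f (x + θ • (y - x)) ≤
      2 ^ d * (volume A + volume B) * ∫⁻ z, f z := by
    intro θ _
    -- The change of variables is made in the endpoint whose coefficient, `θ` or `1 - θ`, is at
    -- least one half, so the Jacobian costs at most `2 ^ d`.
    rcases le_total (1 / 2) θ with h | h
    · calc _ ≤ ∫⁻ x in A, 2 ^ d * ∫⁻ z, f z := by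
            refine lintegral_mono fun x => (setLIntegral_le_lintegral B _).trans ?_
            have e : ∀ y : E d, x + θ • (y - x) = (x - θ • x) + θ • y := fun y => by
              rw [smul_sub]; abel
            simp only [e]
            exact lintegral_add_smul_le f hf _ h
        _ = 2 ^ d * volume A * ∫⁻ z, f z := by
            rw [setLIntegral_const]; ring
        _ ≤ _ := by gcongr; exact le_self_add
    · rw [lintegral_lintegral_swap (Measurable.aemeasurable (by fun_prop))]
      calc _ ≤ ∫⁻ y in B, 2 ^ d * ∫⁻ z, f z := by
            refine lintegral_mono fun y => (setLIntegral_le_lintegral A _).trans ?_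
            have e : ∀ x : E d, x + θ • (y - x) = θ • y + (1 - θ) • x := fun x => by
              rw [smul_sub, sub_smul, one_smul]; abel
            simp only [e]
            exact lintegral_add_smul_le f hf _ (by linarith)
        _ = 2 ^ d * volume B * ∫⁻ z, f z := by
            rw [setLIntegral_const]; ring
        _ ≤ _ := by gcongr; exact le_add_self
  refine (setLIntegral_mono' measurableSet_Icc bound).trans_eq ?_
  simp

/-- The squared increment of a `C¹` function along a segment. -/
lemma enorm_sub_sq_le_lintegral {u : E d → ℝ} (hu : ContDiff ℝ 1 u) (x y : E d) :
    ‖u x - u y‖ₑ ^ 2 ≤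
      ∫⁻ θ in Set.Icc (0 : ℝ) 1, ‖fderiv ℝ u (x + θ • (y - x)) (y - x)‖ₑ ^ 2 := by
  have hder : ∀ θ : ℝ, HasDerivAt (fun θ : ℝ => u (x + θ • (y - x)))
      (fderiv ℝ u (x + θ • (y - x)) (y - x)) θ := by
    intro θ
    have h1 : HasDerivAt (fun θ : ℝ => x + θ • (y - x)) (y - x) θ := by
      simpa using ((hasDerivAt_id θ).smul_const (y - x)).const_add x
    exact ((hu.differentiable (by simp)) _).hasFDerivAt.comp_hasDerivAt θ h1
  have hcont : Continuous fun θ : ℝ => fderiv ℝ u (x + θ • (y - x)) (y - x) :=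
    ((hu.continuous_fderiv (by simp)).comp (by fun_prop)).clm_apply continuous_const
  have h := intervalIntegral.integral_eq_sub_of_hasDerivAt (a := 0) (b := 1)
    (fun θ _ => hder θ) (hcont.intervalIntegrable _ _)
  rw [zero_smul, add_zero, one_smul, add_sub_cancel, intervalIntegral.integral_of_le zero_le_one,
    ← integral_Icc_eq_integral_Ioc] at h
  rw [← neg_sub, enorm_neg, ← h]
  calc _ ≤ (∫⁻ θ in Set.Icc (0 : ℝ) 1, 1 * ‖fderiv ℝ u (x + θ • (y - x)) (y - x)‖ₑ) ^ 2 := by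
        simp only [one_mul]
        gcongr
        exact enorm_integral_le_lintegral_enorm _
    _ ≤ _ := sq_lintegral_mul_le aemeasurable_const hcont.enorm.aemeasurable
    _ = _ := by simp

end Averaging

/-! ### Mollification of Sobolev functions inside the domain. -/

section Mollification

open scoped Convolution

variable (D : LipDomain d)

lemma LipDomain.measurableSet : MeasurableSet D.carrier := D.isOpen.measurableSet

/-- The extension by zero of `u ∈ L²(D)`. -/
noncomputable def extendZero {F : Type*} [NormedAddCommGroup F] (u : Lp F 2 D.vol) : E d → F :=
  D.carrier.indicator u

variable {D}

lemma memLp_extendZero {F : Type*} [NormedAddCommGroup F] (u : Lp F 2 D.vol) :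
    MemLp (extendZero D u) 2 volume :=
  (memLp_indicator_iff_restrict D.measurableSet).mpr (Lp.memLp u)

lemma locallyIntegrable_extendZero {F : Type*} [NormedAddCommGroup F] (u : Lp F 2 D.vol) :
    LocallyIntegrable (extendZero D u) volume :=
  (memLp_extendZero u).locallyIntegrable (by norm_num)

/-- The mollification of `u ∈ L²(D)`, extended by zero. -/
noncomputable def mollify (η : ContDiffBump (0 : E d)) (u : L2 D) : E d → ℝ :=
  η.normed volume ⋆[ContinuousLinearMap.lsmul ℝ ℝ, volume] extendZero D u

lemma contDiff_mollify (η : ContDiffBump (0 : E d)) (u : L2 D) : ContDiff ℝ 1 (mollify η u) :=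
  η.hasCompactSupport_normed.contDiff_convolution_left _ η.contDiff_normed
    (locallyIntegrable_extendZero u)

/-- The mollified squared length of a vector field. -/
noncomputable def mollifiedSq (η : ContDiffBump (0 : E d)) (p : L2vec D) (z : E d) : ENNReal :=
  ∫⁻ y, ENNReal.ofReal (η.normed volume (z - y)) * ‖extendZero D p y‖ₑ ^ 2

lemma measurable_extendZero {F : Type*} [NormedAddCommGroup F] [MeasurableSpace F] [BorelSpace F]
    (u : Lp F 2 D.vol) : Measurable (extendZero D u) :=
  (Lp.stronglyMeasurable u).measurable.indicator D.measurableSet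

lemma measurable_mollifiedSq (η : ContDiffBump (0 : E d)) (p : L2vec D) :
    Measurable (mollifiedSq η p) := by
  have h1 := measurable_extendZero p
  have h2 := (η.continuous_normed (μ := volume)).measurable
  refine Measurable.lintegral_prod_right' (f := fun q : E d × E d =>
    ENNReal.ofReal (η.normed volume (q.1 - q.2)) * ‖extendZero D p q.2‖ₑ ^ 2) ?_
  fun_prop

lemma lintegral_ofReal_normed (η : ContDiffBump (0 : E d)) :
    ∫⁻ z, ENNReal.ofReal (η.normed volume z) = 1 := by
  rw [← ofReal_integral_eq_lintegral_ofReal η.integrable_normed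
    (ae_of_all _ fun z => η.nonneg_normed z), η.integral_normed, ENNReal.ofReal_one]

lemma lintegral_mollifiedSq (η : ContDiffBump (0 : E d)) (p : L2vec D) :
    ∫⁻ z, mollifiedSq η p z = ∫⁻ y, ‖extendZero D p y‖ₑ ^ 2 := by
  have h1 := measurable_extendZero p
  have h2 := (η.continuous_normed (μ := volume)).measurable
  unfold mollifiedSq
  rw [lintegral_lintegral_swap (Measurable.aemeasurable (by fun_prop))]
  refine lintegral_congr fun y => ?_
  rw [lintegral_mul_const _ (by fun_prop),
    lintegral_sub_right_eq_self (fun z => ENNReal.ofReal (η.normed volume z)) y,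
    lintegral_ofReal_normed, one_mul]

lemma isTestFunction_normed_sub (η : ContDiffBump (0 : E d)) {z : E d}
    (hz : Metric.closedBall z η.rOut ⊆ D.carrier) :
    IsTestFunction D fun y => η.normed volume (z - y) := by
  have hη : ContDiff ℝ ∞ (η.normed volume) := η.contDiff_normed
  have hs : tsupport (fun y => η.normed volume (z - y)) ⊆ Metric.closedBall z η.rOut := by
    refine closure_minimal (fun y hy => ?_) Metric.isClosed_closedBall
    have : z - y ∈ Function.support (η.normed volume) := hy
    rw [η.support_normed_eq, Metric.mem_ball, dist_zero_right] at this
    rw [Metric.mem_closedBall, dist_comm, dist_eq_norm]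
    exact this.le
  exact ⟨hη.comp (by fun_prop), HasCompactSupport.intro' (isCompact_closedBall z η.rOut)
    Metric.isClosed_closedBall fun y hy => by_contra fun h => hy (hs (subset_tsupport _ h)),
    hs.trans hz⟩

/-- The translated kernel is an admissible test function when its supporting ball lies in `D`.
Elsewhere the formula may fail, since the extension by zero can jump across the boundary. -/
lemma fderiv_mollify (η : ContDiffBump (0 : E d)) (U : H1 D) {z : E d}
    (hz : Metric.closedBall z η.rOut ⊆ D.carrier) (v : E d) :
    fderiv ℝ (mollify η (toL2 D U)) z v =
      ∫ y, η.normed volume (z - y) * inner ℝ (extendZero D (grad D U) y) v := by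
  have hη : ContDiff ℝ ∞ (η.normed volume) := η.contDiff_normed
  have h1 := η.hasCompactSupport_normed (μ := volume) |>.hasFDerivAt_convolution_left
    (ContinuousLinearMap.lsmul ℝ ℝ) η.contDiff_normed
    (locallyIntegrable_extendZero (toL2 D U)) z
  rw [mollify, h1.fderiv, convolution_eq_swap]
  have hψ := isTestFunction_normed_sub η hz
  have hw := U.2 _ hψ v
  have hder : ∀ y, fderiv ℝ (fun y => η.normed volume (z - y)) y v =
      -fderiv ℝ (η.normed volume) (z - y) v := by
    intro y
    have := ((hη.differentiable (by simp)) (z - y)).hasFDerivAt.comp y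
      ((hasFDerivAt_id y).const_sub z)
    rw [HasFDerivAt.fderiv (f := fun y => η.normed volume (z - y)) this]
    simp
  have hi := (((η.hasCompactSupport_normed (μ := volume)).fderiv ℝ).convolutionExists_left
    ((ContinuousLinearMap.lsmul ℝ ℝ).precompL (E d)) (hη.continuous_fderiv (by simp))
    (locallyIntegrable_extendZero (toL2 D U)) z).integrable_swap
  rw [ContinuousLinearMap.integral_apply hi]
  have e1 : ∫ y, ((ContinuousLinearMap.lsmul ℝ ℝ).precompL (E d) (fderiv ℝ (η.normed volume) (z - y))
      (extendZero D (toL2 D U) y)) v =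
      ∫ y, -(D.carrier.indicator (fun y => (toL2 D U : E d → ℝ) y *
        fderiv ℝ (fun y => η.normed volume (z - y)) y v) y) := by
    refine integral_congr_ae (ae_of_all _ fun y => ?_)
    simp only [hder, ContinuousLinearMap.precompL_apply, ContinuousLinearMap.lsmul_apply,
      extendZero]
    by_cases hy : y ∈ D.carrier
    · simp only [hy, Set.indicator_of_mem, smul_eq_mul]
      ring
    · simp [hy]
  have e2 : ∫ y, η.normed volume (z - y) * inner ℝ (extendZero D (grad D U) y) v =
      ∫ y, D.carrier.indicator (fun y => inner ℝ ((grad D U : E d → E d) y) v *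
        η.normed volume (z - y)) y := by
    refine integral_congr_ae (ae_of_all _ fun y => ?_)
    by_cases hy : y ∈ D.carrier
    · simp only [hy, extendZero, Set.indicator_of_mem, mul_comm]
    · simp [hy, extendZero]
  rw [e1, e2, integral_neg, integral_indicator D.measurableSet, integral_indicator D.measurableSet]
  rw [neg_eq_iff_eq_neg]
  exact hw

/-- The kernel has mass one, so the Cauchy–Schwarz inequality puts the square inside the average. -/
lemma enorm_fderiv_mollify_sq_le (η : ContDiffBump (0 : E d)) (U : H1 D) {z : E d}
    (hz : Metric.closedBall z η.rOut ⊆ D.carrier) (v : E d) :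
    ‖fderiv ℝ (mollify η (toL2 D U)) z v‖ₑ ^ 2 ≤ ‖v‖ₑ ^ 2 * mollifiedSq η (grad D U) z := by
  have m1 : Measurable (extendZero D (grad D U)) := measurable_extendZero _
  have m2 := (η.continuous_normed (μ := volume)).measurable
  rw [fderiv_mollify η U hz]
  have h1 : ‖∫ y, η.normed volume (z - y) * inner ℝ (extendZero D (grad D U) y) v‖ₑ ≤
      ‖v‖ₑ * ∫⁻ y, ENNReal.ofReal (η.normed volume (z - y)) * ‖extendZero D (grad D U) y‖ₑ := by
    refine (enorm_integral_le_lintegral_enorm _).trans ?_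
    rw [← lintegral_const_mul' _ _ (by simp)]
    refine lintegral_mono fun y => ?_
    rw [enorm_mul, Real.enorm_of_nonneg (η.nonneg_normed _)]
    have : ‖(inner ℝ (extendZero D (grad D U) y) v : ℝ)‖ₑ ≤
        ‖extendZero D (grad D U) y‖ₑ * ‖v‖ₑ := by
      simp only [enorm_eq_nnnorm]
      exact_mod_cast nnnorm_inner_le_nnnorm _ _
    calc _ ≤ ENNReal.ofReal (η.normed volume (z - y)) *
          (‖extendZero D (grad D U) y‖ₑ * ‖v‖ₑ) := by gcongr
      _ = _ := by ring
  have h2 := sq_lintegral_mul_le (μ := volume)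
    (w := fun y => ENNReal.ofReal (η.normed volume (z - y)))
    (f := fun y => ‖extendZero D (grad D U) y‖ₑ) (Measurable.aemeasurable (by fun_prop))
    (Measurable.aemeasurable (by fun_prop))
  rw [lintegral_sub_left_eq_self (fun y => ENNReal.ofReal (η.normed volume y)) z,
    lintegral_ofReal_normed, one_mul] at h2
  calc _ ≤ (‖v‖ₑ * ∫⁻ y, ENNReal.ofReal (η.normed volume (z - y)) *
        ‖extendZero D (grad D U) y‖ₑ) ^ 2 := by gcongr
    _ ≤ _ := by
      rw [mul_pow]
      gcongr
      exact h2

/-- The bounded ratio of the radii is required for almost everywhere convergence of the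
mollifications. -/
lemma exists_mollifier_sequence (d : ℕ) : ∃ η : ℕ → ContDiffBump (0 : E d),
    Tendsto (fun n => (η n).rOut) atTop (𝓝 0) ∧ ∀ n, (η n).rOut ≤ 2 * (η n).rIn := by
  refine ⟨fun n => ⟨1 / ((n : ℝ) + 1), 2 * (1 / ((n : ℝ) + 1)), by positivity, ?_⟩, ?_, fun n => le_rfl⟩
  · have : 0 < 1 / ((n : ℝ) + 1) := by positivity
    linarith
  · have := (tendsto_one_div_add_atTop_nhds_zero_nat (𝕜 := ℝ)).const_mul 2
    rwa [mul_zero] at this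

lemma lintegral_lintegral_liminf_le {α β : Type*} [MeasurableSpace α] [MeasurableSpace β]
    {μ : Measure α} {ν : Measure β} [SFinite ν] {g : ℕ → α → β → ENNReal} {C : ENNReal}
    (hg : ∀ n, Measurable fun q : α × β => g n q.1 q.2)
    (hC : ∀ n, ∫⁻ x, ∫⁻ y, g n x y ∂ν ∂μ ≤ C) :
    ∫⁻ x, ∫⁻ y, liminf (fun n => g n x y) atTop ∂ν ∂μ ≤ C := by
  have h1 : ∀ x, ∫⁻ y, liminf (fun n => g n x y) atTop ∂ν ≤
      liminf (fun n => ∫⁻ y, g n x y ∂ν) atTop := fun x =>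
    lintegral_liminf_le fun n => Measurable.comp (g := fun q : α × β => g n q.1 q.2)
      (hg n) measurable_prodMk_left
  have h2 : ∫⁻ x, liminf (fun n => ∫⁻ y, g n x y ∂ν) atTop ∂μ ≤
      liminf (fun n => ∫⁻ x, ∫⁻ y, g n x y ∂ν ∂μ) atTop :=
    lintegral_liminf_le fun n => (hg n).lintegral_prod_right' (ν := ν)
  exact (lintegral_mono h1).trans (h2.trans
    (liminf_le_of_frequently_le' (Frequently.of_forall hC)))

/-- The squared increment of a Sobolev function between two sets which see each other in `D`. -/
theorem lintegral_sub_sq_le_of_segment_subset (U : H1 D) {A B : Set (E d)}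
    (hA : A ⊆ D.carrier) (hB : B ⊆ D.carrier) (hAm : MeasurableSet A) (hBm : MeasurableSet B)
    (h : ∀ x ∈ A, ∀ y ∈ B, segment ℝ x y ⊆ D.carrier) {R : ℝ}
    (hR : ∀ x ∈ A, ∀ y ∈ B, dist x y ≤ R) :
    ∫⁻ x in A, ∫⁻ y in B, ‖(toL2 D U : E d → ℝ) x - (toL2 D U : E d → ℝ) y‖ₑ ^ 2 ≤
      ENNReal.ofReal R ^ 2 * (2 ^ d * (volume A + volume B)) *
        ∫⁻ z, ‖extendZero D (grad D U) z‖ₑ ^ 2 := by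
  let u := extendZero D (toL2 D U)
  obtain ⟨η, hη, hK⟩ := exists_mollifier_sequence d
  have hconv : ∀ᵐ x : E d, Tendsto (fun n => mollify (η n) (toL2 D U) x) atTop (𝓝 (u x)) :=
    ContDiffBump.ae_convolution_tendsto_right_of_locallyIntegrable (K := 2) hη
      (Eventually.of_forall hK) (locallyIntegrable_extendZero _)
  let g : ℕ → E d → E d → ENNReal := fun n x y => ENNReal.ofReal R ^ 2 *
    ∫⁻ θ in Set.Icc (0 : ℝ) 1, mollifiedSq (η n) (grad D U) (x + θ • (y - x))
  -- A compact segment in `D` has a positive distance to the complement. How large `n` must be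
  -- depends on `x` and `y`, hence the passage to the lower limit by Fatou's lemma.
  have hev : ∀ x ∈ A, ∀ y ∈ B, ∀ᶠ n in atTop,
      ‖mollify (η n) (toL2 D U) x - mollify (η n) (toL2 D U) y‖ₑ ^ 2 ≤ g n x y := by
    intro x hx y hy
    have hK : IsCompact (segment ℝ x y) := by
      rw [segment_eq_image']
      exact isCompact_Icc.image (by fun_prop)
    obtain ⟨δ, hδ, hsub⟩ := hK.exists_cthickening_subset_open D.isOpen (h x hx y hy)
    filter_upwards [hη.eventually (gt_mem_nhds hδ)] with n hn
    refine (enorm_sub_sq_le_lintegral (contDiff_mollify _ _) x y).trans ?_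
    simp only [g]
    rw [← lintegral_const_mul' _ _ (by simp)]
    refine setLIntegral_mono' measurableSet_Icc fun θ hθ => ?_
    have hz : x + θ • (y - x) ∈ segment ℝ x y := by
      rw [segment_eq_image']
      exact ⟨θ, hθ, rfl⟩
    refine (enorm_fderiv_mollify_sq_le (η n) U ((Metric.closedBall_subset_cthickening hz _).trans
      ((Metric.cthickening_mono hn.le _).trans hsub)) _).trans ?_
    gcongr
    rw [← ofReal_norm, ← dist_eq_norm, dist_comm]
    exact ENNReal.ofReal_le_ofReal (hR x hx y hy)
  have hlim : ∀ᵐ x ∂volume.restrict A, ∀ᵐ y ∂volume.restrict B,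
      ‖(toL2 D U : E d → ℝ) x - (toL2 D U : E d → ℝ) y‖ₑ ^ 2 ≤
        liminf (fun n => g n x y) atTop := by
    filter_upwards [ae_restrict_of_ae hconv, ae_restrict_mem hAm] with x hx hxA
    filter_upwards [ae_restrict_of_ae hconv, ae_restrict_mem hBm] with y hy hyB
    have e1 : u x = (toL2 D U : E d → ℝ) x := Set.indicator_of_mem (hA hxA) _
    have e2 : u y = (toL2 D U : E d → ℝ) y := Set.indicator_of_mem (hB hyB) _
    rw [← e1, ← e2]
    have ht := ((ENNReal.continuous_pow 2).tendsto _).comp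
      ((continuous_enorm.tendsto _).comp (hx.sub hy))
    rw [← ht.liminf_eq]
    exact liminf_le_liminf (hev x hxA y hyB)
  have hgm : ∀ n, Measurable fun q : E d × E d => g n q.1 q.2 := by
    intro n
    have m := measurable_mollifiedSq (η n) (grad D U)
    have m3 : Measurable fun q : (E d × E d) × ℝ =>
      mollifiedSq (η n) (grad D U) (q.1.1 + q.2 • (q.1.2 - q.1.1)) := by fun_prop
    exact (m3.lintegral_prod_right' (ν := volume.restrict (Set.Icc 0 1))).const_mul _
  have bound : ∀ n, ∫⁻ x in A, ∫⁻ y in B, g n x y ≤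
      ENNReal.ofReal R ^ 2 * (2 ^ d * (volume A + volume B)) *
        ∫⁻ z, ‖extendZero D (grad D U) z‖ₑ ^ 2 := by
    intro n
    have hR2 : ENNReal.ofReal R ^ 2 ≠ ⊤ := by simp
    simp only [g, lintegral_const_mul' _ _ hR2]
    rw [mul_assoc, ← lintegral_mollifiedSq (η n) (grad D U)]
    exact mul_le_mul_right (lintegral_segment_le _ (measurable_mollifiedSq _ _) A B) _
  exact (lintegral_mono_ae (hlim.mono fun x hx => lintegral_mono_ae hx)).trans
    (lintegral_lintegral_liminf_le hgm bound)

end Mollification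

/-! ### Linked sets and the Poincaré inequality. -/

section Linked

/-- The mean squared increments of a function between the sets `A` and `B`. -/
noncomputable def increments (u : E d → ℝ) (A B : Set (E d)) : ENNReal :=
  ∫⁻ x in A, ∫⁻ y in B, ‖u x - u y‖ₑ ^ 2

lemma increments_comm {u : E d → ℝ} (hu : Measurable u) (A B : Set (E d)) :
    increments u A B = increments u B A := by
  unfold increments
  rw [lintegral_lintegral_swap (Measurable.aemeasurable (by fun_prop))]
  refine lintegral_congr fun x => lintegral_congr fun y => ?_
  rw [← enorm_neg, neg_sub]

lemma increments_mono (u : E d → ℝ) {A A' B : Set (E d)} (h : A ⊆ A') :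
    increments u A B ≤ increments u A' B := lintegral_mono_set h

lemma increments_union_le (u : E d → ℝ) (A A' B : Set (E d)) :
    increments u (A ∪ A') B ≤ increments u A B + increments u A' B := lintegral_union_le _ _ _

lemma enorm_sub_sq_le (a b c : ℝ) : ‖a - c‖ₑ ^ 2 ≤ 2 * (‖a - b‖ₑ ^ 2 + ‖b - c‖ₑ ^ 2) := by
  have h : ∀ x : ℝ, ‖x‖ₑ ^ 2 = ENNReal.ofReal (x ^ 2) := fun x => by
    rw [← ofReal_norm, ← ENNReal.ofReal_pow (norm_nonneg x), Real.norm_eq_abs, sq_abs]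
  rw [h, h, h, ← ENNReal.ofReal_add (sq_nonneg _) (sq_nonneg _),
    show (2 : ENNReal) = ENNReal.ofReal 2 by simp, ← ENNReal.ofReal_mul (by norm_num)]
  refine ENNReal.ofReal_le_ofReal ?_
  nlinarith [sq_nonneg (a - b - (b - c))]

/-- The triangle inequality through an intermediate point of `B`, averaged over that point. -/
lemma measure_mul_increments_le {u : E d → ℝ} (hu : Measurable u) (A B C : Set (E d)) :
    volume B * increments u A C ≤
      2 * (volume C * increments u A B + volume A * increments u B C) := by
  have hF : Measurable fun q : E d × E d => ‖u q.1 - u q.2‖ₑ ^ 2 := by fun_prop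
  have h1 : ∀ x z, volume B * ‖u x - u z‖ₑ ^ 2 ≤
      2 * ((∫⁻ y in B, ‖u x - u y‖ₑ ^ 2) + ∫⁻ y in B, ‖u z - u y‖ₑ ^ 2) := by
    intro x z
    rw [← lintegral_add_left (by fun_prop), ← lintegral_const_mul _ (by fun_prop), mul_comm,
      ← setLIntegral_const]
    refine lintegral_mono fun y => ?_
    rw [← enorm_neg (u z - u y), neg_sub]
    exact enorm_sub_sq_le _ _ _
  have ma : Measurable fun x => ∫⁻ y in B, ‖u x - u y‖ₑ ^ 2 := hF.lintegral_prod_right'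
  rw [increments_comm hu B C]
  unfold increments
  calc volume B * ∫⁻ x in A, ∫⁻ z in C, ‖u x - u z‖ₑ ^ 2
      = ∫⁻ x in A, ∫⁻ z in C, volume B * ‖u x - u z‖ₑ ^ 2 := by
        rw [← lintegral_const_mul _ hF.lintegral_prod_right']
        refine lintegral_congr fun x => ?_
        rw [lintegral_const_mul _ (by fun_prop)]
    _ ≤ ∫⁻ x in A, ∫⁻ z in C,
        2 * ((∫⁻ y in B, ‖u x - u y‖ₑ ^ 2) + ∫⁻ y in B, ‖u z - u y‖ₑ ^ 2) :=
        lintegral_mono fun x => lintegral_mono fun z => h1 x z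
    _ = ∫⁻ x in A, 2 * (volume C * (∫⁻ y in B, ‖u x - u y‖ₑ ^ 2) +
        ∫⁻ z in C, ∫⁻ y in B, ‖u z - u y‖ₑ ^ 2) := by
        refine lintegral_congr fun x => ?_
        rw [lintegral_const_mul _ (by fun_prop), lintegral_add_right _ ma, setLIntegral_const,
          mul_comm (volume C)]
    _ = _ := by
        rw [lintegral_const_mul _ (by fun_prop), lintegral_add_left (by fun_prop),
          lintegral_const_mul _ ma, setLIntegral_const, mul_comm (volume A)]

variable (D : LipDomain d)

/-- The Dirichlet energy. -/
noncomputable def energy (U : H1 D) : ENNReal := ∫⁻ z, ‖extendZero D (grad D U) z‖ₑ ^ 2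

/-- The increments of Sobolev functions between `A` and `B` are controlled by their energy. -/
def Linked (A B : Set (E d)) : Prop :=
  ∃ C : ENNReal, C ≠ ⊤ ∧ ∀ U : H1 D, increments (toL2 D U) A B ≤ C * energy D U

variable {D}

lemma measurable_toL2 (U : H1 D) : Measurable (toL2 D U : E d → ℝ) :=
  (Lp.stronglyMeasurable _).measurable

lemma Linked.symm {A B : Set (E d)} (h : Linked D A B) : Linked D B A := by
  obtain ⟨C, hC, h⟩ := h
  exact ⟨C, hC, fun U => increments_comm (measurable_toL2 U) B A ▸ h U⟩

lemma Linked.mono {A A' B : Set (E d)} (h : Linked D A' B) (hA : A ⊆ A') : Linked D A B := by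
  obtain ⟨C, hC, h⟩ := h
  exact ⟨C, hC, fun U => (increments_mono _ hA).trans (h U)⟩

lemma Linked.union {A A' B : Set (E d)} (h : Linked D A B) (h' : Linked D A' B) :
    Linked D (A ∪ A') B := by
  obtain ⟨C, hC, h⟩ := h
  obtain ⟨C', hC', h'⟩ := h'
  refine ⟨C + C', by finiteness, fun U => (increments_union_le _ _ _ _).trans ?_⟩
  rw [add_mul]
  exact add_le_add (h U) (h' U)

lemma Linked.trans {A B C : Set (E d)} (h : Linked D A B) (h' : Linked D B C)
    (hA : volume A ≠ ⊤) (hB : volume B ≠ ⊤) (hB0 : volume B ≠ 0) (hC : volume C ≠ ⊤) :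
    Linked D A C := by
  obtain ⟨c, hc, h⟩ := h
  obtain ⟨c', hc', h'⟩ := h'
  refine ⟨(volume B)⁻¹ * (2 * (volume C * c + volume A * c')), by finiteness, fun U => ?_⟩
  have h1 := measure_mul_increments_le (measurable_toL2 U) A B C
  have h2 : 2 * (volume C * increments (toL2 D U) A B + volume A * increments (toL2 D U) B C) ≤
      2 * (volume C * (c * energy D U) + volume A * (c' * energy D U)) := by
    gcongr
    exacts [h U, h' U]
  calc increments (toL2 D U) A C
      = (volume B)⁻¹ * (volume B * increments (toL2 D U) A C) := by
        rw [← mul_assoc, ENNReal.inv_mul_cancel hB0 hB, one_mul]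
    _ ≤ (volume B)⁻¹ * (2 * (volume C * (c * energy D U) + volume A * (c' * energy D U))) := by
        exact mul_le_mul_right (h1.trans h2) _
    _ = _ := by ring

lemma linked_of_segment_subset {A B : Set (E d)}
    (hA : A ⊆ D.carrier) (hB : B ⊆ D.carrier) (hAm : MeasurableSet A) (hBm : MeasurableSet B)
    (h : ∀ x ∈ A, ∀ y ∈ B, segment ℝ x y ⊆ D.carrier) : Linked D A B := by
  have hfin : volume D.carrier ≠ ⊤ := D.isBounded.measure_lt_top.ne
  have hA' : volume A ≠ ⊤ := ne_top_of_le_ne_top hfin (measure_mono hA)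
  have hB' : volume B ≠ ⊤ := ne_top_of_le_ne_top hfin (measure_mono hB)
  exact ⟨_, by finiteness, fun U => lintegral_sub_sq_le_of_segment_subset U hA hB hAm hBm h
    fun x hx y hy => Metric.dist_le_diam_of_mem D.isBounded (hA hx) (hB hy)⟩

lemma LipDomain.volume_ne_top {A : Set (E d)} (hA : A ⊆ D.carrier) : volume A ≠ ⊤ :=
  ne_top_of_le_ne_top D.isBounded.measure_lt_top.ne (measure_mono hA)

lemma volume_ball_ne_zero (x : E d) {r : ℝ} (hr : 0 < r) : volume (Metric.ball x r) ≠ 0 :=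
  (Metric.measure_ball_pos volume x hr).ne'

lemma linked_ball_self {x : E d} {r : ℝ} (h : Metric.ball x r ⊆ D.carrier) :
    Linked D (Metric.ball x r) (Metric.ball x r) :=
  linked_of_segment_subset h h measurableSet_ball measurableSet_ball fun _ ha _ hb =>
    ((convex_ball x r).segment_subset ha hb).trans h

/-- Two balls in `D` are linked, since `D` is connected. -/
lemma linked_ball_ball {x y : E d} {r s : ℝ} (hr : 0 < r) (hs : 0 < s)
    (hx : Metric.ball x r ⊆ D.carrier) (hy : Metric.ball y s ⊆ D.carrier) :
    Linked D (Metric.ball x r) (Metric.ball y s) := by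
  -- The set `S` is open, contains `y` and is relatively closed in `D`, hence contains `D`.
  set S : Set (E d) := {z | ∃ t > 0, Metric.ball z t ⊆ D.carrier ∧
    Linked D (Metric.ball z t) (Metric.ball y s)}
  have hopen : IsOpen S := by
    refine isOpen_iff_mem_nhds.mpr fun z ⟨t, ht, hzt, hl⟩ => ?_
    refine mem_of_superset (Metric.ball_mem_nhds z ht) fun w hw => ?_
    obtain ⟨t', ht', hsub⟩ := Metric.isOpen_iff.mp Metric.isOpen_ball w hw
    exact ⟨t', ht', hsub.trans hzt, hl.mono hsub⟩
  have hclosed : closure S ∩ D.carrier ⊆ S := by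
    rintro z ⟨hz, hzD⟩
    obtain ⟨t, ht, hzt⟩ := Metric.isOpen_iff.mp D.isOpen z hzD
    obtain ⟨w, hw, t', ht', hwt', hl⟩ :=
      mem_closure_iff.mp hz _ Metric.isOpen_ball (Metric.mem_ball_self ht)
    obtain ⟨t'', ht'', hsub⟩ := Metric.isOpen_iff.mp Metric.isOpen_ball w hw
    have hm : 0 < min t' t'' := lt_min ht' ht''
    have l1 : Linked D (Metric.ball z t) (Metric.ball w (min t' t'')) :=
      ((linked_ball_self hzt).mono
        ((Metric.ball_subset_ball (min_le_right _ _)).trans hsub)).symm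
    have l2 := hl.mono (Metric.ball_subset_ball (min_le_left t' t''))
    exact ⟨t, ht, hzt, l1.trans l2 (D.volume_ne_top hzt)
      (D.volume_ne_top ((Metric.ball_subset_ball (min_le_left _ _)).trans hwt'))
      (volume_ball_ne_zero _ hm) (D.volume_ne_top hy)⟩
  have hall : D.carrier ⊆ S := D.isConnected.isPreconnected.subset_of_closure_inter_subset hopen
    ⟨y, hy (Metric.mem_ball_self hs), s, hs, hy, linked_ball_self hy⟩ hclosed
  obtain ⟨t, ht, hxt, hl⟩ := hall (hx (Metric.mem_ball_self hr))
  have hm : 0 < min r t := lt_min hr ht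
  have l1 : Linked D (Metric.ball x r) (Metric.ball x (min r t)) :=
    ((linked_ball_self hx).mono (Metric.ball_subset_ball (min_le_left _ _))).symm
  exact l1.trans (hl.mono (Metric.ball_subset_ball (min_le_right _ _))) (D.volume_ne_top hx)
    (D.volume_ne_top ((Metric.ball_subset_ball (min_le_left _ _)).trans hx))
    (volume_ball_ne_zero _ hm) (D.volume_ne_top hy)

/-- Near a boundary point, `D` is star-shaped with respect to a ball in `D`. -/
lemma exists_linked_of_mem_frontier {x₀ : E d} (hx₀ : x₀ ∈ frontier D.carrier) :
    ∃ r > 0, ∃ y, ∃ s > 0, Metric.ball y s ⊆ D.carrier ∧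
      Linked D (D.carrier ∩ Metric.ball x₀ r) (Metric.ball y s) := by
  obtain ⟨r, e, K, γ, hr, he, hγ, hD⟩ := D.lipschitzBoundary x₀ hx₀
  -- The factor `4 + 2K` keeps both balls inside the chart. From `x` to `y` the height along `e`
  -- drops by at least `s - 2ρ = 2Kρ`, while the horizontal displacement is at most `2ρ` and changes
  -- `γ` by at most `2Kρ`: the segment stays below the graph.
  set ρ := r / (4 + 2 * K)
  have hK : (0 : ℝ) ≤ K := K.2
  have hρ : 0 < ρ := by positivity
  set s := (2 + 2 * K) * ρ
  have hsρ : s + ρ < r := by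
    have : (4 + 2 * K) * ρ = r := by
      simp only [ρ]; field_simp
    simp only [s]
    linarith
  set P := (Submodule.span ℝ {e})ᗮ.orthogonalProjectionOnto
  have hPe : P e = 0 :=
    Submodule.orthogonalProjectionOnto_orthogonalComplement_singleton_eq_zero e
  have hseg : ∀ x ∈ D.carrier ∩ Metric.ball x₀ ρ, ∀ y ∈ Metric.ball (x₀ - s • e) ρ,
      segment ℝ x y ⊆ D.carrier := by
    rintro x ⟨hxD, hx⟩ y hy
    have hxr : x ∈ Metric.ball x₀ r := Metric.ball_subset_ball (by
      have : 0 ≤ s := by positivity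
      linarith) hx
    have hyr : y ∈ Metric.ball x₀ r := by
      rw [Metric.mem_ball, dist_eq_norm] at hy ⊢
      have e1 : y - x₀ = (y - (x₀ - s • e)) - s • e := by abel
      rw [e1]
      refine (norm_sub_le _ _).trans_lt ?_
      rw [norm_smul, he, mul_one, Real.norm_of_nonneg (by positivity)]
      linarith
    rw [segment_eq_image']
    rintro _ ⟨θ, hθ, rfl⟩
    have hzr : x + θ • (y - x) ∈ Metric.ball x₀ r :=
      (convex_ball x₀ r).add_smul_sub_mem hxr hyr hθ
    rw [Metric.mem_ball, dist_eq_norm] at hx hy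
    set w := (y - (x₀ - s • e)) - (x - x₀)
    have hw : ‖w‖ ≤ 2 * ρ := (norm_sub_le _ _).trans (by linarith)
    have hyx : y - x = w - s • e := by simp only [w]; abel
    have hin : inner ℝ e (y - x) ≤ -(K * (2 * ρ)) := by
      rw [hyx, inner_sub_right, inner_smul_right, real_inner_self_eq_norm_sq, he]
      have := real_inner_le_norm e w
      rw [he] at this
      simp only [s]
      linarith
    have hP : ‖P (y - x)‖ ≤ 2 * ρ := by
      rw [hyx, map_sub, map_smul, hPe, smul_zero, sub_zero]
      exact ((Submodule.norm_orthogonalProjectionOnto_apply_le _ w)).trans hw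
    rw [hD _ hzr]
    have hxe := (hD x hxr).mp hxD
    have hlip := hγ.dist_le_mul (P x) (P (x + θ • (y - x)))
    rw [dist_eq_norm, dist_eq_norm, map_add, map_smul, sub_add_cancel_left, norm_neg, norm_smul,
      Real.norm_of_nonneg hθ.1] at hlip
    have h1 := (le_abs_self _).trans hlip
    have h2 : (K : ℝ) * (θ * ‖P (y - x)‖) ≤ K * (θ * (2 * ρ)) := by
      gcongr
      exact hθ.1
    have h3 := mul_le_mul_of_nonneg_left hin hθ.1
    rw [inner_add_right, inner_smul_right, map_add, map_smul]
    linarith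
  obtain ⟨x, hx, hxD⟩ := mem_closure_iff.mp (frontier_subset_closure hx₀) _ Metric.isOpen_ball
    (Metric.mem_ball_self hρ)
  have hB : Metric.ball (x₀ - s • e) ρ ⊆ D.carrier := fun y hy =>
    hseg x ⟨hxD, hx⟩ y hy (right_mem_segment ℝ x y)
  exact ⟨ρ, hρ, x₀ - s • e, ρ, hρ, hB, linked_of_segment_subset Set.inter_subset_left hB
    (D.measurableSet.inter measurableSet_ball) measurableSet_ball hseg⟩

/-- Being linked to one fixed ball is stable under finite unions and holds locally: near interior
points by connectedness, near boundary points by the Lipschitz condition. Compactness of the closure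
makes it global, and two links through the ball give the claim. -/
lemma linked_self : Linked D D.carrier D.carrier := by
  obtain ⟨y, hy⟩ := D.isConnected.nonempty
  obtain ⟨s, hs, hys⟩ := Metric.isOpen_iff.mp D.isOpen y hy
  have hK : IsCompact (closure D.carrier) := D.isBounded.isCompact_closure
  have h : Linked D (closure D.carrier ∩ D.carrier) (Metric.ball y s) := by
    refine hK.induction_on (p := fun S => Linked D (S ∩ D.carrier) (Metric.ball y s))
      ⟨0, by simp, fun U => by simp [increments]⟩
      (fun S S' h h' => h'.mono (Set.inter_subset_inter_left _ h))
      (fun S S' h h' => by simpa only [Set.union_inter_distrib_right] using h.union h')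
      fun x hx => ?_
    by_cases hxD : x ∈ D.carrier
    · obtain ⟨r, hr, hxr⟩ := Metric.isOpen_iff.mp D.isOpen x hxD
      exact ⟨Metric.ball x r, mem_nhdsWithin_of_mem_nhds (Metric.ball_mem_nhds x hr),
        (linked_ball_ball hr hs hxr hys).mono Set.inter_subset_left⟩
    · have hxf : x ∈ frontier D.carrier := by
        rw [D.isOpen.frontier_eq]
        exact ⟨hx, hxD⟩
      obtain ⟨r, hr, z, t, ht, hzt, hl⟩ := exists_linked_of_mem_frontier hxf
      refine ⟨Metric.ball x r, mem_nhdsWithin_of_mem_nhds (Metric.ball_mem_nhds x hr), ?_⟩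
      rw [Set.inter_comm]
      exact hl.trans (linked_ball_ball ht hs hzt hys) (D.volume_ne_top Set.inter_subset_left)
        (D.volume_ne_top hzt) (volume_ball_ne_zero _ ht) (D.volume_ne_top hys)
  rw [Set.inter_eq_right.mpr subset_closure] at h
  exact h.trans h.symm (D.volume_ne_top le_rfl) (D.volume_ne_top hys) (volume_ball_ne_zero _ hs)
    (D.volume_ne_top le_rfl)

lemma lintegral_enorm_sq_eq {F : Type*} [NormedAddCommGroup F] {μ : Measure (E d)} (f : Lp F 2 μ) :
    ∫⁻ x, ‖f x‖ₑ ^ 2 ∂μ = ENNReal.ofReal (‖f‖ ^ 2) := by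
  have h := eLpNorm_nnreal_pow_eq_lintegral (μ := μ) (f := f) (p := 2) (by norm_num)
  simp only [NNReal.coe_ofNat, ENNReal.rpow_ofNat, ENNReal.coe_ofNat] at h
  rw [← h, ENNReal.ofReal_pow (norm_nonneg f), Lp.norm_def,
    ENNReal.ofReal_toReal (Lp.eLpNorm_ne_top f)]

/-- The Poincaré inequality. -/
theorem exists_poincare (D : LipDomain d) : ∃ C : ℝ, 0 ≤ C ∧ ∀ U : H1 D,
    inner ℝ (toL2 D U) (oneL2 D) = 0 → ‖toL2 D U‖ ^ 2 ≤ C * ‖grad D U‖ ^ 2 := by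
  obtain ⟨c, hc, h⟩ := linked_self (D := D)
  have hv0 : volume D.carrier ≠ 0 := (D.isOpen.measure_pos volume D.isConnected.nonempty).ne'
  have hvt : volume D.carrier ≠ ⊤ := D.volume_ne_top le_rfl
  have hfin : (volume D.carrier)⁻¹ * c ≠ ⊤ := by finiteness
  refine ⟨((volume D.carrier)⁻¹ * c).toReal, ENNReal.toReal_nonneg, fun U hU => ?_⟩
  -- A mean-zero function is orthogonal to constants, so subtracting one cannot decrease its norm.
  -- Taking `a = U(x)` and integrating over `x` produces the increments.
  have h1 : ∀ a : ℝ, ENNReal.ofReal (‖toL2 D U‖ ^ 2) ≤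
      ∫⁻ y in D.carrier, ‖a - (toL2 D U : E d → ℝ) y‖ₑ ^ 2 := by
    intro a
    have e1 : ∫⁻ y in D.carrier, ‖a - (toL2 D U : E d → ℝ) y‖ₑ ^ 2 =
        ∫⁻ y in D.carrier, ‖(toL2 D U - a • oneL2 D : L2 D) y‖ₑ ^ 2 := by
      refine lintegral_congr_ae ?_
      filter_upwards [Lp.coeFn_sub (toL2 D U) (a • oneL2 D), Lp.coeFn_smul a (oneL2 D),
        MemLp.coeFn_toLp (memLp_const (1 : ℝ) (p := 2) (μ := D.vol))] with y h1 h2 h3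
      have h3' : (oneL2 D : E d → ℝ) y = 1 := h3
      rw [h1, Pi.sub_apply, h2, Pi.smul_apply, h3', smul_eq_mul, mul_one, ← enorm_neg, neg_sub]
    rw [e1, lintegral_enorm_sq_eq]
    refine ENNReal.ofReal_le_ofReal ?_
    rw [@norm_sub_sq_real, inner_smul_right, hU]
    nlinarith [sq_nonneg ‖a • oneL2 D‖]
  have h2 : volume D.carrier * ENNReal.ofReal (‖toL2 D U‖ ^ 2) ≤ c * energy D U := by
    refine le_trans ?_ (h U)
    rw [mul_comm, ← setLIntegral_const]
    exact lintegral_mono fun x => h1 _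
  have h3 : energy D U = ENNReal.ofReal (‖grad D U‖ ^ 2) := by
    rw [← lintegral_enorm_sq_eq, energy, ← lintegral_indicator D.measurableSet]
    refine lintegral_congr fun x => ?_
    by_cases hx : x ∈ D.carrier <;> simp [extendZero, hx]
  have h4 : ENNReal.ofReal (‖toL2 D U‖ ^ 2) ≤
      ENNReal.ofReal (((volume D.carrier)⁻¹ * c).toReal * ‖grad D U‖ ^ 2) := by
    rw [ENNReal.ofReal_mul ENNReal.toReal_nonneg, ENNReal.ofReal_toReal hfin, ← h3, mul_assoc]
    calc _ = (volume D.carrier)⁻¹ * (volume D.carrier * ENNReal.ofReal (‖toL2 D U‖ ^ 2)) := by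
          rw [← mul_assoc, ENNReal.inv_mul_cancel hv0 hvt, one_mul]
      _ ≤ _ := by gcongr
  exact (ENNReal.ofReal_le_ofReal_iff (by positivity)).mp h4

end Linked

/-! ### The Neumann problem and the norm of `H`. -/

section Green

variable {D : LipDomain d}

/-- Solvability of `(T g, T J) = ℓ J` for an operator `T` which is bounded below. -/
lemma exists_forall_inner_map_eq {M F : Type*} [NormedAddCommGroup M] [InnerProductSpace ℝ M]
    [CompleteSpace M] [NormedAddCommGroup F] [InnerProductSpace ℝ F] (T : M →L[ℝ] F) {C : ℝ}
    (hC : 0 < C) (hT : ∀ u, ‖u‖ ^ 2 ≤ C * ‖T u‖ ^ 2) (ℓ : StrongDual ℝ M) :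
    ∃ g, ∀ J, inner ℝ (T g) (T J) = ℓ J := by
  let B : M →L[ℝ] M →L[ℝ] ℝ := LinearMap.mkContinuous₂
    (LinearMap.mk₂ ℝ (fun u w : M => inner ℝ (T u) (T w))
      (fun _ _ _ => by simp [inner_add_left]) (fun _ _ _ => by simp [inner_smul_left])
      (fun _ _ _ => by simp [inner_add_right]) (fun _ _ _ => by simp [inner_smul_right]))
    (‖T‖ * ‖T‖) fun u w => by
      simp only [LinearMap.mk₂_apply]
      refine (norm_inner_le_norm _ _).trans ?_
      calc _ ≤ (‖T‖ * ‖u‖) * (‖T‖ * ‖w‖) := by gcongr <;> exact T.le_opNorm _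
        _ = _ := by ring
  have hB : IsCoercive B := by
    refine ⟨C⁻¹, by positivity, fun u => ?_⟩
    change _ ≤ inner ℝ (T u) (T u)
    rw [real_inner_self_eq_norm_sq, mul_assoc, inv_mul_le_iff₀ hC, ← sq]
    exact hT u
  refine ⟨hB.continuousLinearEquivOfBilin.symm ((InnerProductSpace.toDual ℝ M).symm ℓ),
    fun J => ?_⟩
  have h := hB.continuousLinearEquivOfBilin_apply
    (hB.continuousLinearEquivOfBilin.symm ((InnerProductSpace.toDual ℝ M).symm ℓ)) J
  rw [ContinuousLinearEquiv.apply_symm_apply, InnerProductSpace.toDual_symm_apply] at h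
  exact h.symm

lemma exists_mem_forall_inner_map_eq {X F : Type*} [NormedAddCommGroup X] [InnerProductSpace ℝ X]
    [CompleteSpace X] [NormedAddCommGroup F] [InnerProductSpace ℝ F] {M : Submodule ℝ X}
    (hM : IsClosed (M : Set X)) (T : X →L[ℝ] F) {C : ℝ} (hC : 0 < C)
    (hT : ∀ u ∈ M, ‖u‖ ^ 2 ≤ C * ‖T u‖ ^ 2) (ℓ : StrongDual ℝ X) :
    ∃ g ∈ M, ∀ J ∈ M, inner ℝ (T g) (T J) = ℓ J := by
  have : CompleteSpace M := hM.completeSpace_coe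
  obtain ⟨g, hg⟩ := exists_forall_inner_map_eq (T.comp M.subtypeL) hC (fun u => hT u u.2)
    (ℓ.comp M.subtypeL)
  exact ⟨g, g.2, fun J hJ => hg ⟨J, hJ⟩⟩

lemma IsTestFunction.memLp_smul_const {φ : E d → ℝ} (hφ : IsTestFunction D φ) (v : E d) :
    MemLp (fun x => φ x • v) 2 D.vol :=
  ((hφ.smooth.continuous.smul continuous_const).memLp_of_hasCompactSupport
    hφ.compact.smul_right).mono_measure Measure.restrict_le_self

/-- Each test function imposes a closed linear condition. Completeness of `H1 D`, needed for
Lax–Milgram, follows. -/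
lemma isClosed_H1 (D : LipDomain d) : IsClosed (H1 D : Set (WithLp 2 (L2 D × L2vec D))) := by
  have e : (H1 D : Set (WithLp 2 (L2 D × L2vec D))) =
      ⋂ (φ : E d → ℝ) (hφ : IsTestFunction D φ) (v : E d),
        {U | inner ℝ ((hφ.memLp_fderiv v).toLp _) U.fst =
          -inner ℝ (((hφ.memLp_smul_const v).toLp _ : L2vec D)) U.snd} := by
    ext U
    simp only [Set.mem_iInter, Set.mem_ofPred_eq]
    refine forall_congr' fun φ => forall_congr' fun hφ => forall_congr' fun v => ?_
    have h1 : inner ℝ ((hφ.memLp_fderiv v).toLp _) U.fst =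
        ∫ x, (U.fst : E d → ℝ) x * fderiv ℝ φ x v ∂D.vol := by
      rw [L2.inner_def]
      refine integral_congr_ae ?_
      filter_upwards [(hφ.memLp_fderiv v).coeFn_toLp] with x hx
      simp [hx]
    have h2 : inner ℝ (((hφ.memLp_smul_const v).toLp _ : L2vec D)) U.snd =
        ∫ x, inner ℝ ((U.snd : E d → E d) x) v * φ x ∂D.vol := by
      rw [L2.inner_def]
      refine integral_congr_ae ?_
      filter_upwards [(hφ.memLp_smul_const v).coeFn_toLp] with x hx
      rw [hx, inner_smul_left, real_inner_comm]
      simp [mul_comm]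
    rw [h1, h2]
  rw [e]
  refine isClosed_iInter fun φ => isClosed_iInter fun hφ => isClosed_iInter fun v => ?_
  have c1 : Continuous fun U : WithLp 2 (L2 D × L2vec D) => U.fst :=
    (WithLp.fstL 2 ℝ (L2 D) (L2vec D)).continuous
  have c2 : Continuous fun U : WithLp 2 (L2 D × L2vec D) => U.snd :=
    (WithLp.sndL 2 ℝ (L2 D) (L2vec D)).continuous
  exact isClosed_eq (continuous_const.inner c1) (continuous_const.inner c2).neg

instance : CompleteSpace (H1 D) := (isClosed_H1 D).completeSpace_coe

lemma norm_sq_H1 (U : H1 D) : ‖U‖ ^ 2 = ‖toL2 D U‖ ^ 2 + ‖grad D U‖ ^ 2 :=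
  WithLp.prod_norm_sq_eq_of_L2 (U : WithLp 2 (L2 D × L2vec D))

lemma grad_one (D : LipDomain d) : grad D (one D) = 0 := rfl

lemma toL2_one (D : LipDomain d) : toL2 D (one D) = oneL2 D := rfl

lemma oneL2_ne_zero (D : LipDomain d) : oneL2 D ≠ 0 := by
  intro h
  have h1 : (oneL2 D : E d → ℝ) =ᵐ[D.vol] fun _ => 1 :=
    MemLp.coeFn_toLp (memLp_const (1 : ℝ) (p := 2) (μ := D.vol))
  rw [h] at h1
  have h2 : ∀ᵐ x ∂D.vol, False := by
    filter_upwards [h1, Lp.coeFn_zero ℝ 2 D.vol] with x hx hx0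
    rw [hx0] at hx
    simp at hx
  rw [eventually_false_iff_eq_bot, ae_eq_bot, Measure.restrict_eq_zero] at h2
  exact (D.isOpen.measure_pos volume D.isConnected.nonempty).ne' h2

/-- The functions in `H¹(D)` with mean zero. -/
noncomputable def meanZero (D : LipDomain d) : Submodule ℝ (H1 D) :=
  LinearMap.ker (ofL2 D (oneL2 D) : H1 D →ₗ[ℝ] ℝ)

lemma mem_meanZero {U : H1 D} : U ∈ meanZero D ↔ inner ℝ (oneL2 D) (toL2 D U) = 0 := Iff.rfl

lemma isClosed_meanZero (D : LipDomain d) : IsClosed (meanZero D : Set (H1 D)) :=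
  ContinuousLinearMap.isClosed_ker (ofL2 D (oneL2 D))

lemma exists_norm_le_norm_grad (D : LipDomain d) :
    ∃ C : ℝ, 0 < C ∧ ∀ U ∈ meanZero D, ‖U‖ ^ 2 ≤ C * ‖grad D U‖ ^ 2 := by
  obtain ⟨C, hC, h⟩ := exists_poincare D
  refine ⟨C + 1, by positivity, fun U hU => ?_⟩
  have := h U (by rw [real_inner_comm]; exact mem_meanZero.mp hU)
  rw [norm_sq_H1]
  linarith

lemma mem_Hspace {ℓ : H1Dual D} : ℓ ∈ Hspace D ↔ ℓ (one D) = 0 := Iff.rfl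

/-- The Neumann problem is solvable for every `ℓ ∈ H`. -/
theorem exists_isGreenPotential {ℓ : H1Dual D} (hℓ : ℓ ∈ Hspace D) :
    ∃ g, IsGreenPotential D ℓ g := by
  obtain ⟨C, hC, hCg⟩ := exists_norm_le_norm_grad D
  obtain ⟨g, hgm, hg⟩ := exists_mem_forall_inner_map_eq (isClosed_meanZero D) (grad D) hC hCg ℓ
  refine ⟨g, fun J => ?_, by rw [real_inner_comm]; exact mem_meanZero.mp hgm⟩
  -- `c` is the mean of `J`. Removing it changes neither side, as constants have gradient 0 and `ℓ`
  -- annihilates them.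
  set c : ℝ := inner ℝ (oneL2 D) (toL2 D J) / inner ℝ (oneL2 D) (oneL2 D)
  have hne : inner ℝ (oneL2 D) (oneL2 D) ≠ 0 := inner_self_ne_zero.mpr (oneL2_ne_zero D)
  have hm : J - c • one D ∈ meanZero D := by
    rw [mem_meanZero, map_sub, map_smul, toL2_one, inner_sub_right, inner_smul_right]
    simp only [c]
    rw [div_mul_cancel₀ _ hne, sub_self]
  have := hg _ hm
  simp only [map_sub, map_smul, grad_one, smul_zero, sub_zero, mem_Hspace.mp hℓ] at this
  exact this

lemma isGreenPotential_green {ℓ : H1Dual D} (hℓ : ℓ ∈ Hspace D) :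
    IsGreenPotential D ℓ (green D ℓ) := by
  have h := exists_isGreenPotential hℓ
  rw [green, dif_pos h]
  exact h.choose_spec

/-- Solutions differ by an element of zero gradient, so the choice made in `green` is invisible to
`innerH`; linearity on `H` follows. -/
lemma grad_green_eq {ℓ : H1Dual D} (hℓ : ℓ ∈ Hspace D) {g : H1 D}
    (hg : ∀ J : H1 D, inner ℝ (grad D g) (grad D J) = ℓ J) : grad D (green D ℓ) = grad D g := by
  have h := (isGreenPotential_green hℓ).1 (green D ℓ - g)
  have h' := hg (green D ℓ - g)
  rw [← sub_eq_zero, ← inner_self_eq_zero (𝕜 := ℝ), inner_sub_left, ← map_sub, h, h', sub_self]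

lemma grad_green_sub {ℓ m : H1Dual D} (hℓ : ℓ ∈ Hspace D) (hm : m ∈ Hspace D) :
    grad D (green D (ℓ - m)) = grad D (green D ℓ) - grad D (green D m) := by
  rw [← map_sub]
  refine grad_green_eq (sub_mem hℓ hm) fun J => ?_
  rw [map_sub, inner_sub_left, (isGreenPotential_green hℓ).1, (isGreenPotential_green hm).1]
  rfl

lemma innerH_sub_left {ℓ m : H1Dual D} (hℓ : ℓ ∈ Hspace D) (hm : m ∈ Hspace D) (k : H1Dual D) :
    innerH D (ℓ - m) k = innerH D ℓ k - innerH D m k := by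
  rw [innerH, grad_green_sub hℓ hm, inner_sub_left]
  rfl

lemma normH_eq (ℓ : H1Dual D) : normH D ℓ = ‖grad D (green D ℓ)‖ := by
  rw [normH, innerH, real_inner_self_eq_norm_sq, Real.sqrt_sq (norm_nonneg _)]

/-- Test the Neumann problem with its own solution and apply Poincaré. Continuity in the dual norm
of `H¹` thereby gives continuity in the norm of `H`. -/
lemma exists_norm_grad_green_le (D : LipDomain d) :
    ∃ C : ℝ, 0 ≤ C ∧ ∀ ℓ ∈ Hspace D, ‖grad D (green D ℓ)‖ ≤ C * ‖ℓ‖ := by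
  obtain ⟨C, hC, h⟩ := exists_norm_le_norm_grad D
  refine ⟨√C, Real.sqrt_nonneg _, fun ℓ hℓ => ?_⟩
  have hs := isGreenPotential_green hℓ
  set g := green D ℓ
  have h1 : ‖grad D g‖ ^ 2 = ℓ g := by
    rw [← real_inner_self_eq_norm_sq, hs.1]
  have h2 : ‖g‖ ≤ √C * ‖grad D g‖ := by
    rw [← Real.sqrt_sq (norm_nonneg (grad D g)), ← Real.sqrt_mul hC.le]
    exact Real.le_sqrt_of_sq_le (h g (by rw [mem_meanZero, real_inner_comm]; exact hs.2))
  have h3 : ‖grad D g‖ ^ 2 ≤ ‖ℓ‖ * (√C * ‖grad D g‖) := by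
    rw [h1]
    exact (le_abs_self _).trans ((ℓ.le_opNorm g).trans (by gcongr))
  rcases eq_or_lt_of_le (norm_nonneg (grad D g)) with h0 | h0
  · rw [← h0]; positivity
  · refine le_of_mul_le_mul_right ?_ h0
    linarith

lemma continuousOn_grad_green {w : ℝ → H1Dual D} {S : Set ℝ} (hw : ContinuousOn w S)
    (hwH : ∀ t ∈ S, w t ∈ Hspace D) : ContinuousOn (fun t => grad D (green D (w t))) S := by
  obtain ⟨C, hC, h⟩ := exists_norm_grad_green_le D
  have hl : LipschitzOnWith C.toNNReal (fun ℓ => grad D (green D ℓ)) (Hspace D : Set (H1Dual D)) :=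
    LipschitzOnWith.of_dist_le_mul fun ℓ hℓ m hm => by
      rw [dist_eq_norm, dist_eq_norm, ← grad_green_sub hℓ hm, Real.coe_toNNReal C hC]
      exact h _ (sub_mem hℓ hm)
  exact hl.continuousOn.comp hw hwH

end Green

/-! ### A substitute for the chain rule in a Gelfand triple. -/

section Pairing

variable {X : Type*} [NormedAddCommGroup X] [NormedSpace ℝ X] {T : ℝ}
  {G G' : ℝ → StrongDual ℝ X}

lemma absolutelyContinuousOnInterval_apply {a b : ℝ} (hG : AbsolutelyContinuousOnInterval G a b)
    (z : X) : AbsolutelyContinuousOnInterval (fun r => G r z) a b := by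
  unfold AbsolutelyContinuousOnInterval at hG ⊢
  refine squeeze_zero (fun _ => Finset.sum_nonneg fun _ _ => dist_nonneg) (fun I => ?_)
    (by simpa using hG.mul_const ‖z‖)
  rw [Finset.sum_mul]
  refine Finset.sum_le_sum fun i _ => ?_
  rw [dist_eq_norm, dist_eq_norm, ← sub_apply]
  exact ContinuousLinearMap.le_opNorm _ _

/-- The pairing of an increment of `G` with `z` is controlled by the squares of `G'` and `z`. -/
lemma two_mul_sub_apply_le (hG : AbsolutelyContinuousOnInterval G 0 T)
    (hder : ∀ᵐ t ∂timeVol T, HasDerivAt G (G' t) t)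
    (hq : IntegrableOn (fun t => ‖G' t‖ ^ 2) (Set.Icc 0 T)) {s t : ℝ} (hs : 0 ≤ s) (hst : s ≤ t)
    (ht : t ≤ T) (z : X) :
    2 * (G t - G s) z ≤ (∫ r in s..t, ‖G' r‖ ^ 2) + (t - s) * ‖z‖ ^ 2 := by
  have hT : 0 ≤ T := by linarith
  have hac : AbsolutelyContinuousOnInterval (fun r => G r z) s t :=
    (absolutelyContinuousOnInterval_apply hG z).mono (by
      rw [Set.uIcc_of_le hst, Set.uIcc_of_le hT]
      exact Set.Icc_subset_Icc hs ht)
  have hsub : Set.Icc s t ⊆ Set.Icc 0 T := Set.Icc_subset_Icc hs ht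
  have hqi : IntervalIntegrable (fun r => ‖G' r‖ ^ 2) volume s t := by
    rw [intervalIntegrable_iff_integrableOn_Icc_of_le hst]
    exact hq.mono_set hsub
  rw [sub_apply, ← hac.integral_deriv_eq_sub,
    ← intervalIntegral.integral_const_mul, ← smul_eq_mul (t - s), ← intervalIntegral.integral_const,
    ← intervalIntegral.integral_add hqi (by simp)]
  refine intervalIntegral.integral_mono_ae_restrict hst (hac.intervalIntegrable_deriv.const_mul 2)
    (hqi.add (by simp)) ?_
  filter_upwards [ae_mono (Measure.restrict_mono hsub le_rfl) hder] with r hr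
  have h1 : HasDerivAt (fun r => G r z) (G' r z) r := by
    simpa using hr.clm_apply (hasDerivAt_const r z)
  have h2 : G' r z ≤ ‖G' r‖ * ‖z‖ := (le_abs_self _).trans ((G' r).le_opNorm z)
  simp only [h1.deriv]
  nlinarith [sq_nonneg (‖G' r‖ - ‖z‖)]

/-- The form of the chain rule for `½ ‖w‖²` in a Gelfand triple that is needed for monotone
operators: if the increments of `φ` are bounded by the pairing of those of `G` with `z`, and
`⟨G', z⟩ ≤ 0`, then `φ` is bounded by its initial value. -/
theorem le_of_pairing {φ : ℝ → ℝ} {z : ℝ → X} (hφ : ContinuousOn φ (Set.Icc 0 T))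
    (hG : AbsolutelyContinuousOnInterval G 0 T)
    (hder : ∀ᵐ t ∂timeVol T, HasDerivAt G (G' t) t) (hG' : MemLp G' 2 (timeVol T))
    (hz : MemLp z 2 (timeVol T))
    (hle : ∀ᵐ t ∂timeVol T, ∀ s ∈ Set.Icc 0 T, φ t - φ s ≤ 2 * (G t - G s) (z t))
    (hdiss : ∀ᵐ t ∂timeVol T, G' t (z t) ≤ 0) {b : ℝ} (hb : b ∈ Set.Icc 0 T) : φ b ≤ φ 0 := by
  have hq : IntegrableOn (fun t => ‖G' t‖ ^ 2) (Set.Icc 0 T) := hG'.norm.integrable_sq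
  have hp : IntegrableOn (fun t => ‖z t‖ ^ 2) (Set.Icc 0 T) := hz.norm.integrable_sq
  have hsub : Set.Icc 0 b ⊆ Set.Icc 0 T := Set.Icc_subset_Icc le_rfl hb.2
  have hmono : timeVol b ≤ timeVol T := Measure.restrict_mono hsub le_rfl
  -- The domination splits `2 ‖G'(r)‖ ‖z(t)‖` into two squares; the first is extended by zero
  -- because `q` must be integrable on the whole line.
  refine le_of_left_slope_le hb.1 (q := (Set.Icc 0 T).indicator fun t => ‖G' t‖ ^ 2)
    (p := fun t => ‖z t‖ ^ 2) (hφ.mono hsub) (hq.integrable_indicator measurableSet_Icc)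
    (hp.mono_set hsub) (fun t => Set.indicator_nonneg (fun _ _ => by positivity) t)
    (fun t => by positivity) ?_ ?_
  · filter_upwards [ae_mono hmono hle, ae_restrict_mem measurableSet_Icc] with t ht htb s hs
    refine (ht s ⟨hs.1, hs.2.trans (hsub htb).2⟩).trans
      ((two_mul_sub_apply_le hG hder hq hs.1 hs.2 (hsub htb).2 (z t)).trans_eq ?_)
    congr 1
    refine intervalIntegral.integral_congr fun r hr => ?_
    rw [Set.uIcc_of_le hs.2] at hr
    have hr' : r ∈ Set.Icc 0 T := ⟨hs.1.trans hr.1, hr.2.trans (hsub htb).2⟩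
    rw [Set.indicator_of_mem hr']
  · have hne : ∀ᵐ t ∂timeVol b, t ≠ 0 := ae_restrict_of_ae (Measure.ae_ne volume 0)
    filter_upwards [ae_mono hmono hle, ae_mono hmono hder, ae_mono hmono hdiss,
      ae_restrict_mem measurableSet_Icc, hne] with t ht hd hn htb ht0 ε hε
    have htpos : 0 < t := lt_of_le_of_ne htb.1 (Ne.symm ht0)
    -- The increment of `G` is `(t - s) G'(t)` up to an error `c (t - s)`. Paired with `2 z(t)`, the
    -- main part is nonpositive and the error at most `ε (t - s)`; the 1 covers `z t = 0`.
    set c := ε / (2 * (‖z t‖ + 1))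
    have hc : 0 < c := by positivity
    have hce : 2 * c * ‖z t‖ ≤ ε := by
      have : 2 * c * (‖z t‖ + 1) = ε := by simp only [c]; field_simp
      linarith
    have hbound := (hasDerivAt_iff_isLittleO.mp hd).bound hc
    filter_upwards [nhdsWithin_le_nhds hbound, self_mem_nhdsWithin,
      nhdsWithin_le_nhds (lt_mem_nhds htpos)] with s hs hst hs0
    have hst' : s < t := hst
    refine (ht s ⟨hs0.le, hst'.le.trans (hsub htb).2⟩).trans ?_
    rw [Real.norm_eq_abs, abs_of_neg (sub_neg.mpr hst')] at hs
    have h1 : -((G s - G t - (s - t) • G' t) (z t)) ≤ c * -(s - t) * ‖z t‖ :=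
      (neg_le_abs _).trans (((G s - G t - (s - t) • G' t).le_opNorm (z t)).trans (by gcongr))
    simp only [sub_apply, smul_apply, smul_eq_mul] at h1 ⊢
    nlinarith [mul_nonneg (sub_nonneg.mpr hst'.le) (neg_nonneg.mpr hn)]

theorem le_of_pairing_sub {F₁ F₂ F₁' F₂' : ℝ → StrongDual ℝ X} {φ : ℝ → ℝ} {v₁ v₂ : ℝ → X} (f : X)
    (hφ : ContinuousOn φ (Set.Icc 0 T))
    (hac₁ : AbsolutelyContinuousOnInterval F₁ 0 T) (hac₂ : AbsolutelyContinuousOnInterval F₂ 0 T)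
    (hd₁ : ∀ᵐ t ∂timeVol T, HasDerivAt F₁ (F₁' t) t)
    (hd₂ : ∀ᵐ t ∂timeVol T, HasDerivAt F₂ (F₂' t) t)
    (hL₁ : MemLp F₁' 2 (timeVol T)) (hL₂ : MemLp F₂' 2 (timeVol T))
    (hv₁ : MemLp v₁ 2 (timeVol T)) (hv₂ : MemLp v₂ 2 (timeVol T))
    (hle : ∀ᵐ t ∂timeVol T, ∀ s ∈ Set.Icc 0 T, φ t - φ s ≤
      2 * ((F₁ t (v₁ t - v₂ t + f) - F₁ s (v₁ t - v₂ t + f)) -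
        (F₂ t (v₁ t - v₂ t + f) - F₂ s (v₁ t - v₂ t + f))))
    (hdiss : ∀ᵐ t ∂timeVol T, F₁' t (v₁ t - v₂ t + f) ≤ F₂' t (v₁ t - v₂ t + f))
    {b : ℝ} (hb : b ∈ Set.Icc 0 T) : φ b ≤ φ 0 := by
  refine le_of_pairing (G := fun t => F₁ t - F₂ t) (G' := fun t => F₁' t - F₂' t)
    (z := fun t => v₁ t - v₂ t + f) hφ (hac₁.sub hac₂) ?_ (hL₁.sub hL₂)
    ((hv₁.sub hv₂).add (memLp_const f)) ?_ ?_ hb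
  · filter_upwards [hd₁, hd₂] with t h1 h2 using h1.sub h2
  · filter_upwards [hle] with t ht s hs
    refine (ht s hs).trans_eq ?_
    simp only [sub_apply]
    ring
  · filter_upwards [hdiss] with t ht
    rw [sub_apply]
    exact sub_nonpos.mpr ht

end Pairing

/-! ### Monotonicity of the operator and contraction in `H`. -/

section Contraction

variable {D : LipDomain d} {σ : E d → ℝ} {L : ℝ}

/-- Linear growth of the gradient keeps the composition square integrable, so the integrals being
compared converge. -/
lemma memLp_gradient_comp (hc : ConvexOn ℝ Set.univ σ) (hL0 : 0 ≤ L)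
    (hL : ∀ u h, σ (u + h) + σ (u - h) ≤ 2 * σ u + L * ‖h‖ ^ 2) {μ : Measure (E d)}
    [IsFiniteMeasure μ] {a : E d → E d} (ha : MemLp a 2 μ) :
    MemLp (fun x => gradient σ (a x)) 2 μ := by
  have h1 : MemLp (fun x => 4 * L * ‖a x‖) 2 μ := ha.norm.const_mul (4 * L)
  have h2 : MemLp (fun _ : E d => ‖gradient σ 0‖ + 4 * L) 2 μ := memLp_const _
  have h3 : AEStronglyMeasurable (fun x => gradient σ (a x)) μ :=
    ((measurable_gradient σ).comp_aemeasurable ha.aestronglyMeasurable.aemeasurable).aestronglyMeasurable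
  exact (h2.add h1).mono h3 (ae_of_all _ fun x => (norm_gradient_le hc hL0 hL _).trans (le_abs_self _))

lemma integrable_inner_of_memLp {μ : Measure (E d)} {p q : E d → E d} (hp : MemLp p 2 μ)
    (hq : MemLp q 2 μ) : Integrable (fun x => inner ℝ (p x) (q x)) μ :=
  (hp.norm.integrable_mul hq.norm).mono (hp.aestronglyMeasurable.inner hq.aestronglyMeasurable)
    (ae_of_all _ fun _ => (norm_inner_le_norm _ _).trans (le_abs_self _))

lemma integral_inner_gradient_le (hc : ConvexOn ℝ Set.univ σ) (hL0 : 0 ≤ L)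
    (hL : ∀ u h, σ (u + h) + σ (u - h) ≤ 2 * σ u + L * ‖h‖ ^ 2) {μ : Measure (E d)}
    [IsFiniteMeasure μ] {a b c : E d → E d} (ha : MemLp a 2 μ) (hb : MemLp b 2 μ)
    (hcm : MemLp c 2 μ) (habc : c =ᵐ[μ] fun x => a x - b x) :
    ∫ x, inner ℝ (gradient σ (b x)) (c x) ∂μ ≤ ∫ x, inner ℝ (gradient σ (a x)) (c x) ∂μ := by
  have i₁ := integrable_inner_of_memLp (memLp_gradient_comp hc hL0 hL ha) hcm
  have i₂ := integrable_inner_of_memLp (memLp_gradient_comp hc hL0 hL hb) hcm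
  refine integral_mono_ae i₂ i₁ ?_
  filter_upwards [habc] with x hx
  rw [← sub_nonneg, hx, ← inner_sub_left]
  exact inner_gradient_sub_nonneg hc hL _ _

lemma coeFn_add_sub_add (p q r s : L2vec D) :
    ((p + q - (r + s) : L2vec D) : E d → E d) =ᵐ[D.vol] fun x => p x + q x - (r x + s x) := by
  filter_upwards [Lp.coeFn_sub (p + q) (r + s), Lp.coeFn_add p q, Lp.coeFn_add r s] with x e1 e2 e3
  rw [e1, Pi.sub_apply, e2, e3]
  rfl

lemma IsOperatorValue.apply_le (hc : ConvexOn ℝ Set.univ σ) (hL0 : 0 ≤ L)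
    (hL : ∀ u h, σ (u + h) + σ (u - h) ≤ 2 * σ u + L * ‖h‖ ^ 2) {f₁ f₂ : H1 D}
    {v₁ v₂ z : Vspace D} {F₁ F₂ : VDual D} (h₁ : IsOperatorValue D σ f₁ v₁ F₁)
    (h₂ : IsOperatorValue D σ f₂ v₂ F₂)
    (hz : (z : H1 D) = ((v₁ : H1 D) + f₁) - ((v₂ : H1 D) + f₂)) : F₁ z ≤ F₂ z := by
  have hg : grad D z = (grad D v₁ + grad D f₁) - (grad D v₂ + grad D f₂) := by
    rw [hz, map_sub, map_add, map_add]
  rw [h₁ z, h₂ z, neg_le_neg_iff]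
  refine integral_inner_gradient_le hc hL0 hL ((Lp.memLp (grad D v₁)).add (Lp.memLp (grad D f₁)))
    ((Lp.memLp (grad D v₂)).add (Lp.memLp (grad D f₂))) (Lp.memLp (grad D z)) ?_
  rw [hg]
  exact coeFn_add_sub_add _ _ _ _

lemma ofH1_sub (U W : H1 D) : ofH1 D (U - W) = ofH1 D U - ofH1 D W := by simp [ofH1, ofL2]

lemma ofH1_add (U W : H1 D) : ofH1 D (U + W) = ofH1 D U + ofH1 D W := by simp [ofH1, ofL2]

lemma ofH1_sub_add_sub (U W f g : H1 D) :
    ofH1 D U - ofH1 D W + ofH1 D (f - g) = ofH1 D ((U + f) - (W + g)) := by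
  rw [← ofH1_sub, ← ofH1_add]
  congr 1
  abel

/-- The two sides differ by `‖ℓ - m‖_H²`. Only the vector at the later time is paired, so no
regularity of `m` beyond `H` is required. -/
lemma normH_sq_sub_le {ℓ m : H1Dual D} (hℓ : ℓ ∈ Hspace D) (hm : m ∈ Hspace D) :
    normH D ℓ ^ 2 - normH D m ^ 2 ≤ 2 * innerH D (ℓ - m) ℓ := by
  rw [innerH, grad_green_sub hℓ hm, normH_eq, normH_eq, inner_sub_left, real_inner_self_eq_norm_sq]
  have := norm_sub_sq_real (grad D (green D m)) (grad D (green D ℓ))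
  nlinarith [sq_nonneg ‖grad D (green D m) - grad D (green D ℓ)‖]

/-- In the increment of the difference the auxiliary functions cancel, so its inner product with `z`
is a pairing of increments of the two curves in `VDual`. -/
lemma normH_sq_sub_le_of_isImageInVDual {ℓ₁ ℓ₂ m₁ m₂ f₁ f₂ : H1Dual D} (hℓ₁ : ℓ₁ - f₁ ∈ Hspace D)
    (hℓ₂ : ℓ₂ - f₂ ∈ Hspace D) (hm₁ : m₁ - f₁ ∈ Hspace D) (hm₂ : m₂ - f₂ ∈ Hspace D)
    (hℓ : ℓ₁ - ℓ₂ ∈ Hspace D) (hm : m₁ - m₂ ∈ Hspace D)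
    {F₁ F₂ G₁ G₂ : VDual D} (hF₁ : IsImageInVDual D (ℓ₁ - f₁) F₁)
    (hF₂ : IsImageInVDual D (ℓ₂ - f₂) F₂) (hG₁ : IsImageInVDual D (m₁ - f₁) G₁)
    (hG₂ : IsImageInVDual D (m₂ - f₂) G₂) {z : Vspace D} (hz : ℓ₁ - ℓ₂ = ofH1 D z) :
    normH D (ℓ₁ - ℓ₂) ^ 2 - normH D (m₁ - m₂) ^ 2 ≤ 2 * ((F₁ z - G₁ z) - (F₂ z - G₂ z)) := by
  refine (normH_sq_sub_le hℓ hm).trans_eq ?_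
  have e : ℓ₁ - ℓ₂ - (m₁ - m₂) = ((ℓ₁ - f₁) - (m₁ - f₁)) - ((ℓ₂ - f₂) - (m₂ - f₂)) := by abel
  have e₁ : F₁ z = innerH D (ℓ₁ - f₁) (ofH1 D z) := hF₁ z
  have e₂ : F₂ z = innerH D (ℓ₂ - f₂) (ofH1 D z) := hF₂ z
  have e₃ : G₁ z = innerH D (m₁ - f₁) (ofH1 D z) := hG₁ z
  have e₄ : G₂ z = innerH D (m₂ - f₂) (ofH1 D z) := hG₂ z
  rw [e₁, e₂, e₃, e₄, e, innerH_sub_left (sub_mem hℓ₁ hm₁) (sub_mem hℓ₂ hm₂),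
    innerH_sub_left hℓ₁ hm₁, innerH_sub_left hℓ₂ hm₂, hz]

set_option maxHeartbeats 1600000 in
theorem IsSolutionOn.contraction (hc : ConvexOn ℝ Set.univ σ) (hL0 : 0 ≤ L)
    (hL : ∀ u h, σ (u + h) + σ (u - h) ≤ 2 * σ u + L * ‖h‖ ^ 2) {T : ℝ} {h₀ k₀ : H1Dual D}
    {h k : ℝ → H1Dual D} (hh : IsSolutionOn D σ T h₀ h) (hk : IsSolutionOn D σ T k₀ k)
    (h0 : h₀ - k₀ ∈ Hspace D) {t : ℝ} (ht : t ∈ Set.Icc 0 T) :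
    h t - k t ∈ Hspace D ∧ normH D (h t - k t) ≤ normH D (h 0 - k 0) := by
  obtain ⟨f₁, hf₁, hvol₁, hH₁, hC₁, -, v₁, hv₁, hhv₁, F₁, F₁', hF₁, hac₁, hd₁, hL₁, hop₁⟩ := hh
  obtain ⟨f₂, hf₂, hvol₂, hH₂, hC₂, -, v₂, hv₂, hhv₂, F₂, F₂', hF₂, hac₂, hd₂, hL₂, hop₂⟩ := hk
  -- Here the equality of the initial volumes enters: it gives `f₁ - f₂` mean zero.
  have hfH : ofH1 D (f₁ - f₂) ∈ Hspace D := by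
    rw [mem_Hspace, sub_apply, hvol₁, hvol₂] at h0
    rw [mem_Hspace, ofH1_sub]
    exact h0
  have hw : ∀ t, h t - k t = (h t - ofH1 D f₁) - (k t - ofH1 D f₂) + ofH1 D (f₁ - f₂) := by
    intro t
    rw [ofH1_sub]
    abel
  have hwH : ∀ t ∈ Set.Icc 0 T, h t - k t ∈ Hspace D := fun t ht => by
    rw [hw]
    exact add_mem (sub_mem (hH₁ t ht) (hH₂ t ht)) hfH
  have hwC : ContinuousOn (fun t => h t - k t) (Set.Icc 0 T) :=
    ((hC₁.sub hC₂).add continuousOn_const).congr fun t _ => hw t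
  refine ⟨hwH t ht, ?_⟩
  have hφ : ContinuousOn (fun t => normH D (h t - k t) ^ 2) (Set.Icc 0 T) := by
    simp only [normH_eq]
    exact (continuousOn_grad_green hwC hwH).norm.pow 2
  obtain ⟨f, hf⟩ : ∃ f : Vspace D, (f : H1 D) = f₁ - f₂ := ⟨⟨f₁ - f₂, sub_mem hf₁ hf₂, hfH⟩, rfl⟩
  have hzc : ∀ t, ((v₁ t - v₂ t + f : Vspace D) : H1 D) =
      ((v₁ t : H1 D) + f₁) - ((v₂ t : H1 D) + f₂) := fun t => by
    rw [Submodule.coe_add, Submodule.coe_sub, hf]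
    abel
  have hle : ∀ᵐ t ∂timeVol T, ∀ s ∈ Set.Icc 0 T,
      normH D (h t - k t) ^ 2 - normH D (h s - k s) ^ 2 ≤
      2 * ((F₁ t (v₁ t - v₂ t + f) - F₁ s (v₁ t - v₂ t + f)) -
        (F₂ t (v₁ t - v₂ t + f) - F₂ s (v₁ t - v₂ t + f))) := by
    filter_upwards [hhv₁, hhv₂, ae_restrict_mem measurableSet_Icc] with t h1 h2 ht s hs
    refine normH_sq_sub_le_of_isImageInVDual (hH₁ t ht) (hH₂ t ht) (hH₁ s hs) (hH₂ s hs) (hwH t ht)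
      (hwH s hs) (hF₁ t ht) (hF₂ t ht) (hF₁ s hs) (hF₂ s hs) ?_
    rw [hzc, hw, h1, h2]
    exact ofH1_sub_add_sub _ _ _ _
  have hdiss : ∀ᵐ t ∂timeVol T, F₁' t (v₁ t - v₂ t + f) ≤ F₂' t (v₁ t - v₂ t + f) := by
    filter_upwards [hop₁, hop₂] with t h1 h2 using h1.apply_le hc hL0 hL h2 (hzc t)
  exact (sq_le_sq₀ (Real.sqrt_nonneg _) (Real.sqrt_nonneg _)).mp
    (@le_of_pairing_sub (Vspace D) (Vspace D).normedAddCommGroup (Vspace D).normedSpace T _ _ _ _ _ _ _ f hφ hac₁ hac₂ hd₁ hd₂ hL₁ hL₂ hv₁ hv₂ hle hdiss t ht)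

end Contraction

end SurfaceDiffusion

open SurfaceDiffusion in
theorem proposition3p2 {d : ℕ} (hd : 1 ≤ d) (V : ℝ → ℝ) (hV : IsPotential V)
    (σ : E d → ℝ) (hσ : IsSurfaceTension V σ) (D : LipDomain d) :
    -- solutions on a time interval `[0, T]`
    (∀ T : ℝ, 0 < T → ∀ (h₀ k₀ : H1Dual D) (h k : ℝ → H1Dual D),
      IsSolutionOn D σ T h₀ h → IsSolutionOn D σ T k₀ k → h₀ - k₀ ∈ Hspace D →
      ∀ t ∈ Set.Icc 0 T, h t - k t ∈ Hspace D ∧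
        normH D (h t - k t) ≤ normH D (h 0 - k 0)) ∧
    -- solutions on `[0, ∞)`
    (∀ (h₀ k₀ : H1Dual D) (h k : ℝ → H1Dual D),
      IsSolution D σ h₀ h → IsSolution D σ k₀ k → h₀ - k₀ ∈ Hspace D →
      ∀ t : ℝ, 0 ≤ t → h t - k t ∈ Hspace D ∧
        normH D (h t - k t) ≤ normH D (h 0 - k 0)) := by
  have hc := hσ.convexOn hV hd
  obtain ⟨L, hL0, hL⟩ := hσ.exists_midpoint_le hV hd
  refine ⟨fun T _ h₀ k₀ h k hh hk h0 t ht => hh.contraction hc hL0 hL hk h0 ht,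
    fun h₀ k₀ h k hh hk h0 t ht => ?_⟩
  -- The horizon must be positive even for `t = 0`.
  have hT : 0 < t + 1 := by positivity
  exact (hh _ hT).contraction hc hL0 hL (hk _ hT) h0 ⟨ht, by linarith⟩
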